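/- **Theorem 2.1 (Stability of the continuous weak formulation).** Let $d\in\{2,3\}$, and let $\Omega_e,\Omega_p\subset\mathbb R^d$ be disjoint bounded open sets with Lipschitz boundary; put $\Gamma_I=\partial\Omega_e\cap\partial\Omega_p$ and $\Gamma_i=\partial\Omega_i\setminus\Gamma_I$ for $i\in\{e,p\}$, and let $\boldsymbol n_p$ be the outer unit normal of $\Omega_p$. *Coefficients.* Let $\rho_e,\zeta,\mu,\rho_s,\rho_f,\eta,k,m$ be measurable functions with positive lower and upper bounds, $\lambda\ge 0$ and $a>1$ measurable and bounded, $\phi$ measurable with $0<\phi_0\le\phi\le\phi_1<1$, $\beta$ Lipschitz continuous with $\phi<\beta\le 1$, and $\delta\in[0,1]$ a constant. Put $\rho_p=\phi\rho_f+(1-\phi)\rho_s$, $\rho_w=\frac a\phi\rho_f$, $\rho_u=\frac12(1-\phi)\rho_s$, $\boldsymbol\epsilon(\boldsymbol u)=\frac12(\nabla\boldsymbol u+\nabla\boldsymbol u^T)$, $\mathbb C:\boldsymbol\tau=2\mu\boldsymbol\tau+\lambda\,\mathrm{tr}(\boldsymbol\tau)\boldsymbol I$, $\boldsymbol\sigma_e(\boldsymbol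 u)=\mathbb C:\boldsymbol\epsilon(\boldsymbol u)$, $\theta(\boldsymbol u_p,\boldsymbol u_f)=\beta\nabla\cdot\boldsymbol u_p+\nabla\cdot\boldsymbol u_f$ and $p(\boldsymbol u_p,\boldsymbol u_f)=-m\,\theta(\boldsymbol u_p,\boldsymbol u_f)$. *Spaces.* Let $\boldsymbol V_0=\boldsymbol L^2(\Omega_e)\times\boldsymbol L^2(\Omega_p)\times\boldsymbol L^2(\Omega_p)$ and $\boldsymbol V=\boldsymbol V^e\times\boldsymbol V^p\times\boldsymbol W^p$ with $\boldsymbol V^i=\{\boldsymbol v\in\boldsymbol H^1(\Omega_i):\boldsymbol v|_{\Gamma_i}=0\}$ and $\boldsymbol W^p=\{\boldsymbol z\in\boldsymbol H(\mathrm{div},\Omega_p):(\boldsymbol z\cdot\boldsymbol n_p)|_{\Gamma_p}=0\}$. For $\mathsf U=(\boldsymbol u_e,\boldsymbol u_p,\boldsymbol u_f)$ and $\mathsf V=(\boldsymbol v_e,\boldsymbol v_p,\boldsymbol v_f)$ set $$\|\mathsf U\|_0^2=\|\rho_e^{1/2}\boldsymbol u_e\|_{\Omega_e}^2+\|\rho_u^{1/2}\boldsymbol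 u_p\|_{\Omega_p}^2+\|(\rho_f\phi)^{1/2}(\boldsymbol u_p+\phi^{-1}\boldsymbol u_f)\|_{\Omega_p}^2,$$ $$|\mathsf U|_{\boldsymbol V}^2=\|\mathbb C^{1/2}:\boldsymbol\epsilon(\boldsymbol u_e)\|_{\Omega_e}^2+\|\rho_e^{1/2}\zeta\boldsymbol u_e\|_{\Omega_e}^2+\|\mathbb C^{1/2}:\boldsymbol\epsilon(\boldsymbol u_p)\|_{\Omega_p}^2+\|\rho_p^{1/2}\zeta\boldsymbol u_p\|_{\Omega_p}^2+\|m^{1/2}\theta(\boldsymbol u_p,\boldsymbol u_f)\|_{\Omega_p}^2,$$ $$\mathcal M(\mathsf U,\mathsf V)=(\rho_e\boldsymbol u_e,\boldsymbol v_e)_{\Omega_e}+(\rho_p\boldsymbol u_p+\rho_f\boldsymbol u_f,\boldsymbol v_p)_{\Omega_p}+(\rho_f\boldsymbol u_p+\rho_w\boldsymbol u_f,\boldsymbol v_f)_{\Omega_p},$$ $$\mathcal D(\mathsf U,\mathsf V)=(2\rho_e\zeta\boldsymbol u_e,\boldsymbol v_e)_{\Omega_e}+(2\rho_p\zeta\boldsymbol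 u_p,\boldsymbol v_p)_{\Omega_p}+(\eta k^{-1}\boldsymbol u_f,\boldsymbol v_f)_{\Omega_p},$$ $$\begin{aligned}\mathcal A(\mathsf U,\mathsf V)={}&(\boldsymbol\sigma_e(\boldsymbol u_e),\boldsymbol\epsilon(\boldsymbol v_e))_{\Omega_e}+(\rho_e\zeta^2\boldsymbol u_e,\boldsymbol v_e)_{\Omega_e}+(\boldsymbol\sigma_e(\boldsymbol u_p),\boldsymbol\epsilon(\boldsymbol v_p))_{\Omega_p}+(\rho_p\zeta^2\boldsymbol u_p,\boldsymbol v_p)_{\Omega_p}\\&+(m\,\theta(\boldsymbol u_p,\boldsymbol u_f),\theta(\boldsymbol v_p,\boldsymbol v_f))_{\Omega_p},\end{aligned}$$ $$\mathcal C(\mathsf U,\mathsf V)=-\langle\boldsymbol\sigma_e(\boldsymbol u_e)\boldsymbol n_p,\boldsymbol v_p-\boldsymbol v_e\rangle_{\Gamma_I}+\langle p(\boldsymbol u_p,\boldsymbol u_f),((1-\delta)\beta\boldsymbol v_p+\boldsymbol v_f)\cdot\boldsymbol n_p\rangle_{\Gamma_I},$$ with the $H^{1/2}$–$H^{-1/2}$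 duality products (which require $\nabla\cdot\boldsymbol\sigma_e(\boldsymbol u_e)\in\boldsymbol L^2(\Omega_e)$ and $p\in H^1(\Omega_p)$). *Weak problem.* Let $T>0$, $\mathsf F=(\boldsymbol f_e,\boldsymbol f_p,\boldsymbol g_p)\in L^2((0,T);\boldsymbol V_0)$, $\mathsf U_0\in\boldsymbol V$, $\mathsf V_0\in\boldsymbol V_0$, and $\mathcal F(\mathsf V)=(\boldsymbol f_e,\boldsymbol v_e)_{\Omega_e}+(\boldsymbol f_p,\boldsymbol v_p)_{\Omega_p}+(\boldsymbol g_p,\boldsymbol v_f)_{\Omega_p}$. A solution is $\mathsf U\in C^1([0,T];\boldsymbol V_0)\cap C^0([0,T];\boldsymbol V)$ with $\mathsf U(0)=\mathsf U_0$, $\dot{\mathsf U}(0)=\mathsf V_0$ such that, for all $t\in[0,T]$, $\boldsymbol u_e=\boldsymbol u_p$ and $((1-\delta)\beta\boldsymbol u_p+\boldsymbol u_f)\cdot\boldsymbol n_p=0$ on $\Gamma_I$, and $$\mathcal M(\ddot{\mathsf U},\mathsf V)+\mathcal D(\dot{\mathsf U},\mathsf V)+\mathcal A(\mathsf U,\mathsf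 V)+\mathcal C(\mathsf U,\mathsf V)=\mathcal F(\mathsf V)\qquad\forall\,\mathsf V\in\boldsymbol V$$ in the time-integrated sense: for all $t\in[0,T]$ and $\mathsf V\in\boldsymbol V$, $$\mathcal M(\dot{\mathsf U}(t)-\mathsf V_0,\mathsf V)+\int_0^t\big(\mathcal D(\dot{\mathsf U},\mathsf V)+\mathcal A(\mathsf U,\mathsf V)\big)ds+\mathcal C\Big(\int_0^t\mathsf U\,ds,\mathsf V\Big)=\int_0^t\mathcal F(\mathsf V)\,ds .$$ *Energy.* Set $$\|\mathsf U(t)\|_{\mathcal E}^2=\|\dot{\mathsf U}(t)\|_0^2+|\mathsf U(t)|_{\boldsymbol V}^2+\int_0^t\mathcal D(\dot{\mathsf U},\dot{\mathsf U})(s)\,ds+\mathcal D(\mathsf U,\mathsf U)(0),\qquad \|\mathsf U_0\|_{\mathcal E}^2=\|\mathsf V_0\|_0^2+|\mathsf U_0|_{\boldsymbol V}^2+\mathcal D(\mathsf U_0,\mathsf U_0).$$ *Claim.* There is a constant $C>0$, depending only on $d$, the coefficients and $T$, such that for all such $\Omega_e,\Omega_p,\mathsf F,\mathsf U_0,\mathsf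 V_0$ every solution $\mathsf U$ satisfies (the maximum being attained) $$\max_{0\le t\le T}\|\mathsf U(t)\|_{\mathcal E}^2\le C\Big(\|\mathsf U_0\|_{\mathcal E}^2+\int_0^T\big(\|(2\rho_e\zeta)^{-1/2}\boldsymbol f_e\|_{\Omega_e}^2+\|(2\rho_p\zeta)^{-1/2}\boldsymbol f_p\|_{\Omega_p}^2+\|(\eta/k)^{-1/2}\boldsymbol g_p\|_{\Omega_p}^2\big)ds\Big).$$ Here the coefficients are regarded as functions on $\mathbb R^d$, fixed before the two domains. -/

import Mathlib

open MeasureTheory Filter Topology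
open scoped ContDiff RealInnerProductSpace

noncomputable section

namespace PoroElastic

/-- Points of `ℝ^d` and `ℝ^d`-valued vectors, with the Euclidean norm. -/
abbrev Vec (d : ℕ) : Type := EuclideanSpace ℝ (Fin d)

/-- The space `L²(Ω; F)`. -/
abbrev L2 {d : ℕ} (Ω : Set (Vec d)) (F : Type) [NormedAddCommGroup F] : Type :=
  Lp F 2 (volume.restrict Ω)

/-! ### Domains -/

/-- Bounded open set with Lipschitz boundary: near each boundary point the set is, in the direction
of some unit vector `ν`, the strict epigraph of a Lipschitz function of the component orthogonal to
`ν`. The empty set is allowed. -/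
def IsLipschitzDomain {d : ℕ} (Ω : Set (Vec d)) : Prop :=
  IsOpen Ω ∧ Bornology.IsBounded Ω ∧
    ∀ x₀ ∈ frontier Ω, ∃ ν : Vec d, ‖ν‖ = 1 ∧ ∃ r : ℝ, 0 < r ∧
      ∃ (K : NNReal) (g : Vec d → ℝ), LipschitzWith K g ∧
        ∀ x ∈ Metric.ball x₀ r, (x ∈ Ω ↔ g (x - ⟪ν, x⟫ • ν) < ⟪ν, x⟫)

/-- The interface `Γ_I = ∂Ω_e ∩ ∂Ω_p`. -/
def interface {d : ℕ} (Ωe Ωp : Set (Vec d)) : Set (Vec d) := frontier Ωe ∩ frontier Ωp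

/-- The surface measure `H^{d-1}` restricted to a subset `Γ` of a boundary. -/
def surface {d : ℕ} (Γ : Set (Vec d)) : Measure (Vec d) := (μH[(d : ℝ) - 1]).restrict Γ

/-! ### Weak derivatives -/

/-- Scalar test functions `C_c^∞(Ω)`. -/
def IsTest {d : ℕ} (Ω : Set (Vec d)) (ψ : Vec d → ℝ) : Prop :=
  ContDiff ℝ ∞ ψ ∧ HasCompactSupport ψ ∧ tsupport ψ ⊆ Ω

/-- `G` is the weak gradient of `u` in `Ω`; `G x e` is the derivative in the direction `e`. -/
def IsWeakGrad {d : ℕ} {F : Type} [NormedAddCommGroup F] [NormedSpace ℝ F]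
    (Ω : Set (Vec d)) (u : Vec d → F) (G : Vec d → (Vec d →L[ℝ] F)) : Prop :=
  ∀ ψ, IsTest Ω ψ → ∀ e : Vec d,
    ∫ x in Ω, (fderiv ℝ ψ x e) • u x = - ∫ x in Ω, ψ x • G x e

/-- `g` is the weak divergence of the vector field `z` in `Ω`. -/
def IsWeakDiv {d : ℕ} (Ω : Set (Vec d)) (z : Vec d → Vec d) (g : Vec d → ℝ) : Prop :=
  ∀ ψ, IsTest Ω ψ → ∫ x in Ω, fderiv ℝ ψ x (z x) = - ∫ x in Ω, ψ x * g x

/-- The vector `∇ψ(x)`, in coordinates. -/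
def gradVec {d : ℕ} (ψ : Vec d → ℝ) (x : Vec d) (j : Fin d) : ℝ :=
  fderiv ℝ ψ x (EuclideanSpace.single j 1)

/-- `s` is the weak (row-wise) divergence of the matrix field `S` in `Ω`:
`s_i = ∑ j, ∂_j S_{ij}`. -/
def IsWeakDivTensor {d : ℕ} (Ω : Set (Vec d)) (S : Vec d → Matrix (Fin d) (Fin d) ℝ)
    (s : Vec d → Vec d) : Prop :=
  ∀ ψ, IsTest Ω ψ → ∀ i : Fin d,
    ∫ x in Ω, ∑ j, S x i j * gradVec ψ x j = - ∫ x in Ω, ψ x * s x i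

/-! ### Traces

The trace operator of `H¹(Ω)` is the continuous extension to `H¹(Ω)` of the restriction to `∂Ω` of
smooth functions; it is described through its graph. -/

/-- `τ ∈ L²(∂Ω)` is the trace on `∂Ω` of the function `u ∈ H¹(Ω)` with weak gradient `G`: there are
smooth functions which converge to `u` in `H¹(Ω)` and whose restrictions converge to `τ` in
`L²(∂Ω)`. -/
def IsTrace {d : ℕ} {F : Type} [NormedAddCommGroup F] [NormedSpace ℝ F]
    (Ω : Set (Vec d)) (u : Vec d → F) (G : Vec d → (Vec d →L[ℝ] F)) (τ : Vec d → F) : Prop :=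
  MemLp τ 2 (surface (frontier Ω)) ∧
    ∃ φ : ℕ → Vec d → F, (∀ n, ContDiff ℝ ∞ (φ n)) ∧
      Tendsto (fun n => eLpNorm (φ n - u) 2 (volume.restrict Ω)) atTop (𝓝 0) ∧
      Tendsto (fun n => eLpNorm (fderiv ℝ (φ n) - G) 2 (volume.restrict Ω)) atTop (𝓝 0) ∧
      Tendsto (fun n => eLpNorm (φ n - τ) 2 (surface (frontier Ω))) atTop (𝓝 0)

/-- Ambient space of `H¹(Ω; F)`: pairs (function, gradient), with the `H¹` topology. -/
abbrev H1Graph {d : ℕ} (Ω : Set (Vec d)) (F : Type) [NormedAddCommGroup F] [NormedSpace ℝ F] :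
    Type := L2 Ω F × L2 Ω (Vec d →L[ℝ] F)

/-- Ambient space of `H(div, Ω)`: pairs (field, divergence), with the `H(div)` topology. -/
abbrev HdivGraph {d : ℕ} (Ω : Set (Vec d)) : Type := L2 Ω (Vec d) × L2 Ω ℝ

/-- Membership in `H¹(Ω; F)`: the second component is the weak gradient of the first. -/
def MemH1 {d : ℕ} {F : Type} [NormedAddCommGroup F] [NormedSpace ℝ F]
    (Ω : Set (Vec d)) (u : H1Graph Ω F) : Prop :=
  IsWeakGrad Ω u.1 u.2

/-- `u ∈ H¹(Ω; F)` has vanishing trace on the part `Γ` of `∂Ω`. -/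
def VanishesOn {d : ℕ} {F : Type} [NormedAddCommGroup F] [NormedSpace ℝ F]
    (Ω Γ : Set (Vec d)) (u : H1Graph Ω F) : Prop :=
  ∃ τ : Vec d → F, IsTrace Ω u.1 u.2 τ ∧ ∀ᵐ x ∂(surface Γ), τ x = 0

/-- The space `{v ∈ H¹(Ω)^d : v = 0 on ∂Ω \ Γ_I}`. -/
def MemVdisp {d : ℕ} (Ω ΓI : Set (Vec d)) (v : H1Graph Ω (Vec d)) : Prop :=
  MemH1 Ω v ∧ VanishesOn Ω (frontier Ω \ ΓI) v

/-- The duality product `⟨z · n, q⟩_{∂Ω}` between the normal trace (in `H^{-1/2}`) of a field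
`z ∈ H(div, Ω)` with divergence `g` and the trace (in `H^{1/2}`) of `q ∈ H¹(Ω)` with gradient `Q`,
given by Green's formula. -/
def normalPairing {d : ℕ} (Ω : Set (Vec d)) (z : Vec d → Vec d) (g : Vec d → ℝ)
    (q : Vec d → ℝ) (Q : Vec d → (Vec d →L[ℝ] ℝ)) : ℝ :=
  ∫ x in Ω, (q x * g x + Q x (z x))

/-- The space `{z ∈ H(div, Ω) : z · n = 0 on ∂Ω \ Γ_I}`; the normal trace vanishes on `∂Ω \ Γ_I` when
it annihilates every `q ∈ H¹(Ω)` with `q = 0` on `Γ_I`. -/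
def MemWfilt {d : ℕ} (Ω ΓI : Set (Vec d)) (z : HdivGraph Ω) : Prop :=
  IsWeakDiv Ω z.1 z.2 ∧
    ∀ q : H1Graph Ω ℝ, MemH1 Ω q → VanishesOn Ω ΓI q → normalPairing Ω z.1 z.2 q.1 q.2 = 0

/-! ### The spaces `V_0` and `V` -/

/-- `V_0 = L²(Ω_e)^d × L²(Ω_p)^d × L²(Ω_p)^d`. -/
abbrev SpaceV0 {d : ℕ} (Ωe Ωp : Set (Vec d)) : Type :=
  L2 Ωe (Vec d) × L2 Ωp (Vec d) × L2 Ωp (Vec d)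

/-- Ambient space of `V`, with the topology of `H¹ × H¹ × H(div)`. -/
abbrev Ambient {d : ℕ} (Ωe Ωp : Set (Vec d)) : Type :=
  H1Graph Ωe (Vec d) × H1Graph Ωp (Vec d) × HdivGraph Ωp

/-- Membership in `V = V^e × V^p × W^p`. -/
def MemV {d : ℕ} (Ωe Ωp : Set (Vec d)) (U : Ambient Ωe Ωp) : Prop :=
  MemVdisp Ωe (interface Ωe Ωp) U.1 ∧ MemVdisp Ωp (interface Ωe Ωp) U.2.1 ∧
    MemWfilt Ωp (interface Ωe Ωp) U.2.2

/-- The triple `(u_e, u_p, u_f)` underlying an element of `V`, as an element of `V_0`. -/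
def toV0 {d : ℕ} {Ωe Ωp : Set (Vec d)} (U : Ambient Ωe Ωp) : SpaceV0 Ωe Ωp :=
  (U.1.1, U.2.1.1, U.2.2.1)

/-- The fields `u ∈ H¹(Ω_e)^d` and `v ∈ H¹(Ω_p)^d` have the same trace on `Γ_I`. -/
def AgreeOnInterface {d : ℕ} (Ωe Ωp : Set (Vec d)) (u : H1Graph Ωe (Vec d))
    (v : H1Graph Ωp (Vec d)) : Prop :=
  ∃ τu τv : Vec d → Vec d, IsTrace Ωe u.1 u.2 τu ∧ IsTrace Ωp v.1 v.2 τv ∧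
    ∀ᵐ x ∂(surface (interface Ωe Ωp)), τu x = τv x

/-- `ℓ` is a field of `H¹(Ω_e)^d` which vanishes on `∂Ω_e \ Γ_I` and equals `v_p - v_e` on `Γ_I`. -/
def IsLifting {d : ℕ} (Ωe Ωp : Set (Vec d)) (ve : H1Graph Ωe (Vec d))
    (vp : H1Graph Ωp (Vec d)) (ℓ : H1Graph Ωe (Vec d)) : Prop :=
  MemVdisp Ωe (interface Ωe Ωp) ℓ ∧
    ∃ τe τp τℓ : Vec d → Vec d, IsTrace Ωe ve.1 ve.2 τe ∧ IsTrace Ωp vp.1 vp.2 τp ∧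
      IsTrace Ωe ℓ.1 ℓ.2 τℓ ∧ ∀ᵐ x ∂(surface (interface Ωe Ωp)), τℓ x = τp x - τe x

/-! ### Material coefficients -/

/-- A measurable coefficient with positive lower and upper bounds. -/
def IsPosCoeff {d : ℕ} (f : Vec d → ℝ) : Prop :=
  Measurable f ∧ ∃ c K : ℝ, 0 < c ∧ ∀ x, c ≤ f x ∧ f x ≤ K

/-- The physical coefficients of the poroelastic-elastic problem. -/
structure Material (d : ℕ) where
  /-- density of the elastic medium -/
  ρe : Vec d → ℝ
  /-- attenuation parameter -/
  ζ : Vec d → ℝ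
  /-- first Lamé coefficient -/
  lam : Vec d → ℝ
  /-- second Lamé coefficient -/
  mu : Vec d → ℝ
  /-- solid density -/
  ρs : Vec d → ℝ
  /-- fluid density -/
  ρf : Vec d → ℝ
  /-- porosity -/
  φ : Vec d → ℝ
  /-- tortuosity -/
  a : Vec d → ℝ
  /-- viscosity of the fluid -/
  η : Vec d → ℝ
  /-- permeability -/
  k : Vec d → ℝ
  /-- Biot modulus -/
  m : Vec d → ℝ
  /-- Biot--Willis coefficient -/
  β : Vec d → ℝ
  /-- fluid entry resistance of the interface -/
  δ : ℝ
  ρe_pos : IsPosCoeff ρe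
  ζ_pos : IsPosCoeff ζ
  lam_nonneg : Measurable lam ∧ ∃ K : ℝ, ∀ x, 0 ≤ lam x ∧ lam x ≤ K
  mu_pos : IsPosCoeff mu
  ρs_pos : IsPosCoeff ρs
  ρf_pos : IsPosCoeff ρf
  φ_bounds : Measurable φ ∧ ∃ φ₀ φ₁ : ℝ, 0 < φ₀ ∧ φ₁ < 1 ∧ ∀ x, φ₀ ≤ φ x ∧ φ x ≤ φ₁
  a_gt_one : Measurable a ∧ ∃ K : ℝ, ∀ x, 1 < a x ∧ a x ≤ K
  η_pos : IsPosCoeff η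
  k_pos : IsPosCoeff k
  m_pos : IsPosCoeff m
  β_lipschitz : ∃ K : NNReal, LipschitzWith K β
  β_bounds : ∀ x, φ x < β x ∧ β x ≤ 1
  δ_mem : δ ∈ Set.Icc (0 : ℝ) 1

namespace Material

variable {d : ℕ} (P : Material d)

/-- `ρ_p = φ ρ_f + (1 - φ) ρ_s`. -/
def ρp (x : Vec d) : ℝ := P.φ x * P.ρf x + (1 - P.φ x) * P.ρs x

/-- `ρ_w = (a / φ) ρ_f`. -/
def ρw (x : Vec d) : ℝ := P.a x / P.φ x * P.ρf x

/-- `ρ_u = (1 - φ) ρ_s / 2`. -/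
def ρu (x : Vec d) : ℝ := (1 - P.φ x) * P.ρs x / 2

end Material

/-! ### Stress, strain and pressure -/

/-- The Jacobian matrix `(∇u)_{ij} = ∂_j u_i`. -/
def jac {d : ℕ} (G : Vec d →L[ℝ] Vec d) : Matrix (Fin d) (Fin d) ℝ :=
  Matrix.of fun i j => G (EuclideanSpace.single j 1) i

/-- The strain `ε(u) = (∇u + ∇uᵀ) / 2`. -/
def strain {d : ℕ} (G : Vec d →L[ℝ] Vec d) : Matrix (Fin d) (Fin d) ℝ :=
  (1 / 2 : ℝ) • (jac G + (jac G).transpose)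

/-- The divergence `∇ · u`, the trace of the gradient. -/
def divOf {d : ℕ} (G : Vec d →L[ℝ] Vec d) : ℝ := (jac G).trace

/-- The elasticity tensor at `x`: `ℂ : τ = 2 μ τ + λ tr(τ) I`. -/
def elasticity {d : ℕ} (P : Material d) (x : Vec d) (τ : Matrix (Fin d) (Fin d) ℝ) :
    Matrix (Fin d) (Fin d) ℝ :=
  (2 * P.mu x) • τ + (P.lam x * τ.trace) • (1 : Matrix (Fin d) (Fin d) ℝ)

/-- The stress `σ_e(u) = ℂ : ε(u)` at `x`. -/
def stress {d : ℕ} (P : Material d) (x : Vec d) (G : Vec d →L[ℝ] Vec d) :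
    Matrix (Fin d) (Fin d) ℝ := elasticity P x (strain G)

/-- The Frobenius product `A : B`. -/
def ddot {d : ℕ} (A B : Matrix (Fin d) (Fin d) ℝ) : ℝ := ∑ i, ∑ j, A i j * B i j

/-- The field `β ∇ · u_p + ∇ · u_f` on `Ω_p`. -/
def fluidContent {d : ℕ} (P : Material d) {Ω : Set (Vec d)} (up : H1Graph Ω (Vec d))
    (uf : HdivGraph Ω) (x : Vec d) : ℝ := P.β x * divOf (up.2 x) + uf.2 x

/-- The pressure `p(u_p, u_f) = - m (β ∇ · u_p + ∇ · u_f)`. -/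
def pressure {d : ℕ} (P : Material d) {Ω : Set (Vec d)} (up : H1Graph Ω (Vec d))
    (uf : HdivGraph Ω) (x : Vec d) : ℝ := - P.m x * fluidContent P up uf x

/-- The flux field `(1 - δ) β u_p + u_f` on `Ω_p`. -/
def fluxField {d : ℕ} (P : Material d) {Ω : Set (Vec d)} (up : H1Graph Ω (Vec d))
    (uf : HdivGraph Ω) (x : Vec d) : Vec d := ((1 - P.δ) * P.β x) • up.1 x + uf.1 x

/-! ### Bilinear forms and norms -/

section Forms

variable {d : ℕ} {Ωe Ωp : Set (Vec d)} (P : Material d)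

/-- The form `𝓜`. -/
def formM (U V : SpaceV0 Ωe Ωp) : ℝ :=
  (∫ x in Ωe, ⟪P.ρe x • U.1 x, V.1 x⟫) +
  (∫ x in Ωp, ⟪P.ρp x • U.2.1 x + P.ρf x • U.2.2 x, V.2.1 x⟫) +
  (∫ x in Ωp, ⟪P.ρf x • U.2.1 x + P.ρw x • U.2.2 x, V.2.2 x⟫)

/-- The form `𝓓`. -/
def formD (U V : SpaceV0 Ωe Ωp) : ℝ :=
  (∫ x in Ωe, ⟪(2 * P.ρe x * P.ζ x) • U.1 x, V.1 x⟫) +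
  (∫ x in Ωp, ⟪(2 * P.ρp x * P.ζ x) • U.2.1 x, V.2.1 x⟫) +
  (∫ x in Ωp, ⟪(P.η x / P.k x) • U.2.2 x, V.2.2 x⟫)

/-- The form `𝓐`. -/
def formA (U V : Ambient Ωe Ωp) : ℝ :=
  (∫ x in Ωe, ddot (stress P x (U.1.2 x)) (strain (V.1.2 x))) +
  (∫ x in Ωe, ⟪(P.ρe x * P.ζ x ^ 2) • U.1.1 x, V.1.1 x⟫) +
  (∫ x in Ωp, ddot (stress P x (U.2.1.2 x)) (strain (V.2.1.2 x))) +
  (∫ x in Ωp, ⟪(P.ρp x * P.ζ x ^ 2) • U.2.1.1 x, V.2.1.1 x⟫) +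
  (∫ x in Ωp, P.m x * fluidContent P U.2.1 U.2.2 x * fluidContent P V.2.1 V.2.2 x)

/-- The load functional `𝓕(V)` for the data `F = (f_e, f_p, g_p)`. -/
def load (F V : SpaceV0 Ωe Ωp) : ℝ :=
  (∫ x in Ωe, ⟪F.1 x, V.1 x⟫) + (∫ x in Ωp, ⟪F.2.1 x, V.2.1 x⟫) + (∫ x in Ωp, ⟪F.2.2 x, V.2.2 x⟫)

/-- `c = - ⟨σ_e(u_e) n_p, v_p - v_e⟩_{Γ_I}`. As `n_p = - n_e` on `Γ_I`, this is
`⟨σ_e(u_e) n_e, ℓ⟩_{∂Ω_e}` for any `ℓ ∈ V^e` equal to `v_p - v_e` on `Γ_I`. The normal trace in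
`H^{-1/2}` exists because the divergence `s` of the stress is square integrable, and the product is
given by Green's formula. -/
def IsStressPairing (ue ve : H1Graph Ωe (Vec d)) (vp : H1Graph Ωp (Vec d)) (c : ℝ) : Prop :=
  ∃ s : L2 Ωe (Vec d), IsWeakDivTensor Ωe (fun x => stress P x (ue.2 x)) s ∧
    (∃ ℓ, IsLifting Ωe Ωp ve vp ℓ) ∧
    ∀ ℓ, IsLifting Ωe Ωp ve vp ℓ →
      c = ∫ x in Ωe, (ddot (stress P x (ue.2 x)) (jac (ℓ.2 x)) + ⟪s x, ℓ.1 x⟫)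

/-- `c = ⟨p(u_p, u_f), ((1 - δ) β v_p + v_f) · n_p⟩_{Γ_I}`, where `p(u_p, u_f) ∈ H¹(Ω_p)` has the
gradient `Q`. For `(v_p, v_f) ∈ V^p × W^p` the normal trace vanishes on `∂Ω_p \ Γ_I`, so the product
over `Γ_I` is the one over `∂Ω_p`. -/
def IsPressurePairing (up : H1Graph Ωp (Vec d)) (uf : HdivGraph Ωp)
    (vp : H1Graph Ωp (Vec d)) (vf : HdivGraph Ωp) (c : ℝ) : Prop :=
  ∃ (Q : L2 Ωp (Vec d →L[ℝ] ℝ)) (g : L2 Ωp ℝ),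
    IsWeakGrad Ωp (pressure P up uf) Q ∧ IsWeakDiv Ωp (fluxField P vp vf) g ∧
      c = normalPairing Ωp (fluxField P vp vf) g (pressure P up uf) Q

/-- `c` is the value `𝓒(U, V)` of the interface form. -/
def IsFormC (U V : Ambient Ωe Ωp) (c : ℝ) : Prop :=
  ∃ c₁ c₂ : ℝ, IsStressPairing P U.1 V.1 V.2.1 c₁ ∧
    IsPressurePairing P U.2.1 U.2.2 V.2.1 V.2.2 c₂ ∧ c = c₁ + c₂

/-- The condition `((1 - δ) β u_p + u_f) · n_p = 0` on `Γ_I`, in `H^{-1/2}`. For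
`(u_p, u_f) ∈ V^p × W^p` the normal trace vanishes on `∂Ω_p \ Γ_I` anyway, so the condition is that it
vanishes on `∂Ω_p`. -/
def NoFlow (up : H1Graph Ωp (Vec d)) (uf : HdivGraph Ωp) : Prop :=
  ∃ g : L2 Ωp ℝ, IsWeakDiv Ωp (fluxField P up uf) g ∧
    ∀ q : H1Graph Ωp ℝ, MemH1 Ωp q → normalPairing Ωp (fluxField P up uf) g q.1 q.2 = 0

/-- The square of the weighted norm `‖U‖_0` of `V_0`. -/
def normV0Sq (U : SpaceV0 Ωe Ωp) : ℝ :=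
  (∫ x in Ωe, P.ρe x * ‖U.1 x‖ ^ 2) + (∫ x in Ωp, P.ρu x * ‖U.2.1 x‖ ^ 2) +
  (∫ x in Ωp, P.ρf x * P.φ x * ‖U.2.1 x + (P.φ x)⁻¹ • U.2.2 x‖ ^ 2)

/-- The square of the seminorm `|U|_V`; here `|ℂ^{1/2} : ε|² = (ℂ : ε) : ε` pointwise. -/
def seminormVSq (U : Ambient Ωe Ωp) : ℝ :=
  (∫ x in Ωe, ddot (elasticity P x (strain (U.1.2 x))) (strain (U.1.2 x))) +
  (∫ x in Ωe, P.ρe x * P.ζ x ^ 2 * ‖U.1.1 x‖ ^ 2) +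
  (∫ x in Ωp, ddot (elasticity P x (strain (U.2.1.2 x))) (strain (U.2.1.2 x))) +
  (∫ x in Ωp, P.ρp x * P.ζ x ^ 2 * ‖U.2.1.1 x‖ ^ 2) +
  (∫ x in Ωp, P.m x * fluidContent P U.2.1 U.2.2 x ^ 2)

/-- The squared energy norm `‖U(t)‖_𝓔²` of a trajectory `U` with velocity `Udot`. -/
def energySq (U : ℝ → Ambient Ωe Ωp) (Udot : ℝ → SpaceV0 Ωe Ωp) (t : ℝ) : ℝ :=
  normV0Sq P (Udot t) + seminormVSq P (U t) + (∫ s in (0 : ℝ)..t, formD P (Udot s) (Udot s)) +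
    formD P (toV0 (U 0)) (toV0 (U 0))

/-- The squared energy norm `‖U_0‖_𝓔²` of initial data `(U_0, V_0)`. -/
def initialEnergySq (U₀ : Ambient Ωe Ωp) (V₀ : SpaceV0 Ωe Ωp) : ℝ :=
  normV0Sq P V₀ + seminormVSq P U₀ + formD P (toV0 U₀) (toV0 U₀)

/-- The squared weighted norm of the data `F = (f_e, f_p, g_p)`:
`‖(2 ρ_e ζ)^{-1/2} f_e‖² + ‖(2 ρ_p ζ)^{-1/2} f_p‖² + ‖(η / k)^{-1/2} g_p‖²`. -/
def dataSq (F : SpaceV0 Ωe Ωp) : ℝ :=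
  (∫ x in Ωe, (2 * P.ρe x * P.ζ x)⁻¹ * ‖F.1 x‖ ^ 2) +
  (∫ x in Ωp, (2 * P.ρp x * P.ζ x)⁻¹ * ‖F.2.1 x‖ ^ 2) +
  (∫ x in Ωp, (P.η x / P.k x)⁻¹ * ‖F.2.2 x‖ ^ 2)

/-- `U` is a solution on `[0, T]`, with velocity `Udot`, of the coupled weak problem with load `F`
and initial data `U_0`, `V_0`: `U ∈ C⁰([0,T]; V) ∩ C¹([0,T]; V_0)`, the displacement and flow
conditions hold on `Γ_I`, and
`𝓜(Ü, V) + 𝓓(U̇, V) + 𝓐(U, V) + 𝓒(U, V) = 𝓕(V)` for all `V ∈ V`.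
As `U` has no more regularity in time than the energy norm requires, the equation is imposed in the
form integrated over `(0, t)`, for every `t`; by linearity, the time integral of `𝓒(U, V)` is
`𝓒(∫ U, V)`. -/
structure IsWeakSolution (T : ℝ) (F : ℝ → SpaceV0 Ωe Ωp) (U₀ : Ambient Ωe Ωp)
    (V₀ : SpaceV0 Ωe Ωp) (U : ℝ → Ambient Ωe Ωp) (Udot : ℝ → SpaceV0 Ωe Ωp) : Prop where
  memV : ∀ t ∈ Set.Icc (0 : ℝ) T, MemV Ωe Ωp (U t)
  continuousOn : ContinuousOn U (Set.Icc 0 T)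
  hasDeriv : ∀ t ∈ Set.Icc (0 : ℝ) T,
    HasDerivWithinAt (fun s => toV0 (U s)) (Udot t) (Set.Icc 0 T) t
  continuousOn_deriv : ContinuousOn Udot (Set.Icc 0 T)
  agree : ∀ t ∈ Set.Icc (0 : ℝ) T, AgreeOnInterface Ωe Ωp (U t).1 (U t).2.1
  noFlow : ∀ t ∈ Set.Icc (0 : ℝ) T, NoFlow P (U t).2.1 (U t).2.2
  initial : U 0 = U₀
  initial_deriv : Udot 0 = V₀
  equation : ∀ t ∈ Set.Icc (0 : ℝ) T, ∀ V : Ambient Ωe Ωp, MemV Ωe Ωp V →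
    ∃ c : ℝ, IsFormC P (∫ s in (0 : ℝ)..t, U s) V c ∧
      (formM P (Udot t) (toV0 V) - formM P V₀ (toV0 V)) +
        (∫ s in (0 : ℝ)..t, formD P (Udot s) (toV0 V)) +
        (∫ s in (0 : ℝ)..t, formA P (U s) V) + c =
      ∫ s in (0 : ℝ)..t, load (F s) (toV0 V)

end Forms

end PoroElastic

end

/-! Formally one tests with the velocity: the equation becomes `d/dt (M(v,v) + A(u,u))/2 + D(v,v) =
L(F,v)`, the interface form drops out because the velocity inherits the interface conditions, and
Young's inequality absorbs half of the damping. But the velocity lies only in `V_0`, so it is not an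
admissible test function.

The remedy is to test with increments of the solution. On `[s, s+h]` the integrated equation is
tested with `u(s+h) - u(s)`, which equals `h w`, where `w` is the forward average of the velocity.
Since the derivative of a forward average is a difference quotient, the mass and stiffness terms are
exact derivatives of the quadratic forms at the averages of `v` and `u`. Hence a regularized energy
decreases on `[0, T-h]`; averages are jointly continuous in `(h, s)`, so `h → 0` gives the
inequality for the solution itself. This is `energy_inequality_of_continuous`, an abstract statement
in which only values `u(b)` are used as test functions.

Three facts connect it to the problem. The interface form vanishes on test functions satisfying the
interface conditions (`formC_eq_zero`), in particular on each `U(b)`. Young's inequality with the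
damping weights bounds the load (`loadForm_le`). The mass form is equivalent to the kinetic norm,
uniformly in the domains (`kineticForm_le_massForm`, `exists_massForm_le`), because the comparison
is pointwise in the coefficients. -/

namespace PoroElastic

/-! ### Steklov averages -/

section Average

variable {E : Type*} [NormedAddCommGroup E] [NormedSpace ℝ E]

/-- The forward Steklov average of `f` over `[s, s + h]`. -/
noncomputable def forwardAverage (f : ℝ → E) (h s : ℝ) : E := ∫ r in (0 : ℝ)..1, f (s + h * r)

lemma forwardAverage_zero [CompleteSpace E] (f : ℝ → E) (s : ℝ) : forwardAverage f 0 s = f s := by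
  simp [forwardAverage]

lemma smul_forwardAverage (f : ℝ → E) (h s : ℝ) :
    h • forwardAverage f h s = ∫ r in s..(s + h), f r := by
  simp [forwardAverage, intervalIntegral.smul_integral_comp_add_mul]

lemma forwardAverage_eq (f : ℝ → E) {h : ℝ} (hh : h ≠ 0) (s : ℝ) :
    forwardAverage f h s = h⁻¹ • ∫ r in s..(s + h), f r := by
  rw [← smul_forwardAverage, smul_smul, inv_mul_cancel₀ hh, one_smul]

/-- Averaging over the fixed interval `[0, 1]`, with no division by `h`, makes `h = 0` a regular
value. The passage `h → 0` is then mere evaluation of a continuous function. -/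
lemma continuous_forwardAverage {f : ℝ → E} (hf : Continuous f) :
    Continuous fun p : ℝ × ℝ => forwardAverage f p.1 p.2 := by
  unfold forwardAverage
  apply intervalIntegral.continuous_parametric_intervalIntegral_of_continuous'
  simp only [Function.uncurry_def]
  fun_prop

/-- For `f = u` the derivative is a multiple of an increment of `u`, hence again a combination of
admissible test functions. -/
lemma hasDerivAt_forwardAverage [CompleteSpace E] {f : ℝ → E} (hf : Continuous f) {h : ℝ}
    (hh : h ≠ 0) (s : ℝ) :
    HasDerivAt (forwardAverage f h) (h⁻¹ • (f (s + h) - f s)) s := by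
  have h1 : ∀ x, HasDerivAt (fun x => ∫ r in (0 : ℝ)..x, f r) (f x) x := fun x =>
    intervalIntegral.integral_hasDerivAt_right (hf.intervalIntegrable _ _)
      (hf.stronglyMeasurableAtFilter _ _) hf.continuousAt
  have h2 := (((h1 (s + h)).comp_add_const s h).sub (h1 s)).const_smul h⁻¹
  refine h2.congr_of_eventuallyEq (Eventually.of_forall fun x => ?_)
  simp only [Pi.smul_apply, Pi.sub_apply]
  rw [forwardAverage_eq f hh, intervalIntegral.integral_interval_sub_left
    (hf.intervalIntegrable _ _) (hf.intervalIntegrable _ _)]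

end Average

/-! ### Energy inequality for abstract second-order evolution equations -/

section EnergyInequality

variable {H X : Type*} [NormedAddCommGroup H] [NormedSpace ℝ H] [CompleteSpace H]
  [NormedAddCommGroup X] [NormedSpace ℝ X] [CompleteSpace X]

lemma hasDerivAt_quadratic {E : Type*} [NormedAddCommGroup E] [NormedSpace ℝ E]
    {B : E →L[ℝ] E →L[ℝ] ℝ} (hB : ∀ x y, B x y = B y x) {f : ℝ → E} {f' : E} {s : ℝ}
    (hf : HasDerivAt f f' s) : HasDerivAt (fun r => B (f r) (f r)) (2 * B (f s) f') s := by
  have h1 : HasDerivAt (fun r => B (f r)) (B f') s := B.hasFDerivAt.comp_hasDerivAt s hf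
  refine (h1.clm_apply hf).congr_deriv ?_
  rw [hB f']; ring

/-- With the test function frozen at `u b`, the time integrals pass inside the continuous forms, and
the equations at times `s + h` and `s` can be subtracted. -/
lemma equation_increment {ι : X →L[ℝ] H} {M D L : H →L[ℝ] H →L[ℝ] ℝ} {A : X →L[ℝ] X →L[ℝ] ℝ}
    {T : ℝ} {u : ℝ → X} {v F : ℝ → H} (hu : Continuous u) (hv : Continuous v)
    (hF : IntervalIntegrable F volume 0 T)
    (heq : ∀ t ∈ Set.Icc 0 T, ∀ b ∈ Set.Icc 0 T,
      M (v t - v 0) (ι (u b)) + (∫ s in (0 : ℝ)..t, D (v s) (ι (u b))) +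
        (∫ s in (0 : ℝ)..t, A (u s) (u b)) = ∫ s in (0 : ℝ)..t, L (F s) (ι (u b)))
    {s h : ℝ} (hs : 0 ≤ s) (hh : 0 ≤ h) (hsT : s + h ≤ T) {b : ℝ} (hb : b ∈ Set.Icc 0 T) :
    M (v (s + h) - v s) (ι (u b)) + D (∫ r in s..(s + h), v r) (ι (u b)) +
      A (∫ r in s..(s + h), u r) (u b) = L (∫ r in s..(s + h), F r) (ι (u b)) := by
  have hF' : ∀ t ∈ Set.Icc 0 T, IntervalIntegrable F volume 0 t := fun t ht =>
    hF.mono_set (Set.uIcc_subset_uIcc Set.left_mem_uIcc (Set.Icc_subset_uIcc ht))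
  have key : ∀ t ∈ Set.Icc 0 T, M (v t - v 0) (ι (u b)) + D (∫ r in (0 : ℝ)..t, v r) (ι (u b)) +
      A (∫ r in (0 : ℝ)..t, u r) (u b) = L (∫ r in (0 : ℝ)..t, F r) (ι (u b)) := by
    intro t ht
    have e1 := (D.flip (ι (u b))).intervalIntegral_comp_comm
      (hv.intervalIntegrable (μ := volume) 0 t)
    have e2 := (A.flip (u b)).intervalIntegral_comp_comm (hu.intervalIntegrable (μ := volume) 0 t)
    have e3 := (L.flip (ι (u b))).intervalIntegral_comp_comm (hF' t ht)
    simp only [ContinuousLinearMap.flip_apply] at e1 e2 e3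
    rw [← e1, ← e2, ← e3]
    exact heq t ht b hb
  have ms : s ∈ Set.Icc 0 T := ⟨hs, by linarith⟩
  have msh : s + h ∈ Set.Icc 0 T := ⟨by linarith, hsT⟩
  have k1 := key _ ms
  have k2 := key _ msh
  rw [← intervalIntegral.integral_interval_sub_left (hv.intervalIntegrable 0 (s + h))
      (hv.intervalIntegrable 0 s),
    ← intervalIntegral.integral_interval_sub_left (hu.intervalIntegrable 0 (s + h))
      (hu.intervalIntegrable 0 s),
    ← intervalIntegral.integral_interval_sub_left (hF' _ msh) (hF' _ ms)]
  simp only [map_sub, sub_apply] at k1 k2 ⊢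
  linarith

/-- Energy inequality for solutions of `M v' + D v + A u = L F`, `(ι u)' = v`, in time-integrated
form, which may be tested only with the values of `u`. -/
theorem energy_inequality_of_continuous {ι : X →L[ℝ] H} {M D L : H →L[ℝ] H →L[ℝ] ℝ}
    {A : X →L[ℝ] X →L[ℝ] ℝ} (hM : ∀ x y, M x y = M y x) (hA : ∀ x y, A x y = A y x)
    {T : ℝ} {u : ℝ → X} {v F : ℝ → H} {n : ℝ → ℝ} (hu : Continuous u) (hv : Continuous v)
    (hF : IntervalIntegrable F volume 0 T)
    (hn : ∀ a b, IntervalIntegrable n volume a b)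
    (hL : ∀ s ∈ Set.Ioc 0 T, ∀ w, L (F s) w ≤ (D w w + n s) / 2)
    (hderiv : ∀ t ∈ Set.Icc 0 T, ι (u t) - ι (u 0) = ∫ s in (0 : ℝ)..t, v s)
    (heq : ∀ t ∈ Set.Icc 0 T, ∀ b ∈ Set.Icc 0 T,
      M (v t - v 0) (ι (u b)) + (∫ s in (0 : ℝ)..t, D (v s) (ι (u b))) +
        (∫ s in (0 : ℝ)..t, A (u s) (u b)) = ∫ s in (0 : ℝ)..t, L (F s) (ι (u b)))
    {t : ℝ} (ht : t ∈ Set.Icc 0 T) :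
    M (v t) (v t) + A (u t) (u t) + (∫ s in (0 : ℝ)..t, D (v s) (v s)) ≤
      M (v 0) (v 0) + A (u 0) (u 0) + ∫ s in (0 : ℝ)..t, n s := by
  -- `n` is only integrable. Its primitive is continuous, so the forward average of `G` is
  -- differentiable, and its derivative is the average of `n` over `[s, s + h]`.
  set G : ℝ → ℝ := fun t => ∫ s in (0 : ℝ)..t, n s with hG
  have hGc : Continuous G := intervalIntegral.continuous_primitive hn 0
  have hcv := continuous_forwardAverage hv
  have hcu := continuous_forwardAverage hu
  have hcG := continuous_forwardAverage hGc
  set Φ : ℝ → ℝ → ℝ := fun h s =>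
    M (forwardAverage v h s) (forwardAverage v h s) +
      A (forwardAverage u h s) (forwardAverage u h s) +
      (∫ r in (0 : ℝ)..s, D (forwardAverage v h r) (forwardAverage v h r)) -
      forwardAverage G h s with hΦ
  have hΦc : Continuous fun p : ℝ × ℝ => Φ p.1 p.2 := by
    have hi : Continuous fun p : ℝ × ℝ =>
        ∫ r in (0 : ℝ)..p.2, D (forwardAverage v p.1 r) (forwardAverage v p.1 r) := by
      apply intervalIntegral.continuous_parametric_intervalIntegral_of_continuous
        (f := fun (p : ℝ × ℝ) r => D (forwardAverage v p.1 r) (forwardAverage v p.1 r))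
        _ continuous_snd
      have : Continuous fun q : (ℝ × ℝ) × ℝ => forwardAverage v q.1.1 q.2 :=
        hcv.comp (by fun_prop : Continuous fun q : (ℝ × ℝ) × ℝ => (q.1.1, q.2))
      simp only [Function.uncurry_def]
      fun_prop
    simp only [hΦ]
    fun_prop
  have hanti : ∀ h > 0, AntitoneOn (Φ h) (Set.Icc 0 (T - h)) := by
    intro h hh
    have hder : ∀ s, HasDerivAt (Φ h)
        (2 * M (forwardAverage v h s) (h⁻¹ • (v (s + h) - v s)) +
          2 * A (forwardAverage u h s) (h⁻¹ • (u (s + h) - u s)) +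
          D (forwardAverage v h s) (forwardAverage v h s) -
          h⁻¹ • (G (s + h) - G s)) s := by
      intro s
      have hc : Continuous fun r => D (forwardAverage v h r) (forwardAverage v h r) := by
        have : Continuous fun r => forwardAverage v h r :=
          hcv.comp (by fun_prop : Continuous fun r : ℝ => (h, r))
        fun_prop
      have hi := intervalIntegral.integral_hasDerivAt_right (hc.intervalIntegrable 0 s)
        (hc.stronglyMeasurableAtFilter _ _) hc.continuousAt
      exact (((hasDerivAt_quadratic hM (hasDerivAt_forwardAverage hv hh.ne' s)).add
        (hasDerivAt_quadratic hA (hasDerivAt_forwardAverage hu hh.ne' s))).add hi).sub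
          (hasDerivAt_forwardAverage hGc hh.ne' s)
    refine antitoneOn_of_deriv_nonpos (convex_Icc _ _)
      (fun s _ => (hder s).continuousAt.continuousWithinAt)
      (fun s _ => (hder s).differentiableAt.differentiableWithinAt) fun s hs => ?_
    rw [interior_Icc] at hs
    rw [(hder s).deriv]
    have ms : s ∈ Set.Icc 0 T := ⟨hs.1.le, by linarith [hs.2]⟩
    have msh : s + h ∈ Set.Icc 0 T := ⟨by linarith [hs.1], by linarith [hs.2]⟩
    -- The same increment of the equation is tested with `u (s + h)` and with `u s`; the difference
    -- is the equation tested with `h • w`.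
    have e1 := equation_increment hu hv hF heq hs.1.le hh.le msh.2 msh
    have e2 := equation_increment hu hv hF heq hs.1.le hh.le msh.2 ms
    set w := forwardAverage v h s with hw
    have hincr : ι (u (s + h)) - ι (u s) = h • w := by
      rw [hw, smul_forwardAverage, ← intervalIntegral.integral_interval_sub_left
        (hv.intervalIntegrable 0 (s + h)) (hv.intervalIntegrable 0 s), ← hderiv _ ms,
        ← hderiv _ msh]
      abel
    have e3 : M (v (s + h) - v s) (h • w) + h * D w (h • w) +
        h * A (forwardAverage u h s) (u (s + h) - u s) = L (∫ r in s..(s + h), F r) (h • w) := by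
      rw [← smul_forwardAverage, ← smul_forwardAverage] at e1 e2
      rw [← hincr]
      simp only [map_sub, map_smul, smul_apply, smul_eq_mul,
        sub_apply] at e1 e2 ⊢
      linarith
    have hFs : IntervalIntegrable F volume s (s + h) :=
      hF.mono_set (Set.uIcc_subset_uIcc (Set.Icc_subset_uIcc ms) (Set.Icc_subset_uIcc msh))
    -- The Young-type bound `hL` is integrated over `[s, s + h]` with `w` fixed. Half of the damping
    -- at `w` is thereby absorbed.
    have e4 : L (∫ r in s..(s + h), F r) w ≤ (h * D w w + (G (s + h) - G s)) / 2 := by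
      have c1 := (L.flip w).intervalIntegral_comp_comm hFs
      simp only [ContinuousLinearMap.flip_apply] at c1
      have c2 : (∫ r in s..(s + h), L (F r) w) ≤ ∫ r in s..(s + h), (D w w + n r) / 2 := by
        apply intervalIntegral.integral_mono_on_of_le_Ioo (by linarith)
        · have := (L.flip w).integrable_comp hFs.1
          exact (intervalIntegrable_iff_integrableOn_Ioc_of_le (by linarith)).2 this
        · exact (intervalIntegrable_const.add (hn _ _)).div_const 2
        · intro r hr
          exact hL r ⟨by linarith [hr.1, hs.1], by linarith [hr.2, msh.2]⟩ w
      rw [← c1]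
      refine c2.trans_eq ?_
      rw [intervalIntegral.integral_div, intervalIntegral.integral_add intervalIntegrable_const
        (hn _ _), intervalIntegral.integral_const, hG]
      simp only [intervalIntegral.integral_interval_sub_left (hn 0 (s + h)) (hn 0 s)]
      simp
    simp only [map_smul, smul_eq_mul] at e3 ⊢
    rw [hM w]
    -- One factor `h` comes from the test function `h • w` and is cancelled; dividing by a second
    -- one produces the difference quotients of `hder`.
    have e5 : h⁻¹ * (M (v (s + h) - v s) w) + D w w +
        h⁻¹ * A (forwardAverage u h s) (u (s + h) - u s) =
          h⁻¹ * L (∫ r in s..(s + h), F r) w := by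
      have : h * (M (v (s + h) - v s) w + h * D w w +
        A (forwardAverage u h s) (u (s + h) - u s) - L (∫ r in s..(s + h), F r) w) = 0 := by
        linarith
      have h0 := (mul_eq_zero.1 this).resolve_left hh.ne'
      field_simp
      linarith
    have e6 := mul_le_mul_of_nonneg_left e4 (inv_nonneg.2 hh.le)
    have e7 : h⁻¹ * ((h * D w w + (G (s + h) - G s)) / 2) =
        (D w w + h⁻¹ * (G (s + h) - G s)) / 2 := by
      field_simp
    linarith
  have hlim : ∀ s ∈ Set.Ico 0 T, Φ 0 s ≤ Φ 0 0 := by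
    intro s hs
    have c1 : Tendsto (fun h => Φ h s) (𝓝[>] 0) (𝓝 (Φ 0 s)) :=
      ((hΦc.comp (by fun_prop : Continuous fun h : ℝ => (h, s))).tendsto 0).mono_left
        nhdsWithin_le_nhds
    have c2 : Tendsto (fun h => Φ h 0) (𝓝[>] 0) (𝓝 (Φ 0 0)) :=
      ((hΦc.comp (by fun_prop : Continuous fun h : ℝ => (h, (0 : ℝ)))).tendsto 0).mono_left
        nhdsWithin_le_nhds
    refine le_of_tendsto_of_tendsto c1 c2 ?_
    filter_upwards [Ioo_mem_nhdsGT (sub_pos.2 hs.2)] with h hh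
    exact hanti h hh.1 ⟨le_rfl, by linarith [hs.1, hh.2]⟩ ⟨hs.1, by linarith [hh.2]⟩ hs.1
  -- Forward averages need room to the right, so `hlim` stops short of `T`; the endpoint follows by
  -- continuity from the left.
  have hfin : Φ 0 t ≤ Φ 0 0 := by
    rcases ht.2.lt_or_eq with h | h
    · exact hlim t ⟨ht.1, h⟩
    · rcases ht.1.lt_or_eq with h' | h'
      · have c1 : Tendsto (fun s => Φ 0 s) (𝓝[<] t) (𝓝 (Φ 0 t)) :=
          ((hΦc.comp (by fun_prop : Continuous fun s : ℝ => ((0 : ℝ), s))).tendsto t).mono_left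
            nhdsWithin_le_nhds
        refine le_of_tendsto c1 ?_
        filter_upwards [Ioo_mem_nhdsLT h'] with s hs
        exact hlim s ⟨hs.1.le, h ▸ hs.2⟩
      · rw [← h']
  simp only [hΦ, forwardAverage_zero, hG, intervalIntegral.integral_same] at hfin
  linarith

/-- Energy inequality on a compact time interval, for trajectories defined on that interval only. -/
theorem energy_inequality {ι : X →L[ℝ] H} {M D L : H →L[ℝ] H →L[ℝ] ℝ}
    {A : X →L[ℝ] X →L[ℝ] ℝ} (hM : ∀ x y, M x y = M y x) (hA : ∀ x y, A x y = A y x)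
    {T : ℝ} (hT : 0 < T) {u : ℝ → X} {v F : ℝ → H} {n : ℝ → ℝ} (hu : ContinuousOn u (Set.Icc 0 T))
    (hv : ContinuousOn v (Set.Icc 0 T))
    (hderiv : ∀ t ∈ Set.Icc 0 T, HasDerivWithinAt (fun s => ι (u s)) (v t) (Set.Icc 0 T) t)
    (hF : IntervalIntegrable F volume 0 T) (hn : IntervalIntegrable n volume 0 T)
    (hL : ∀ s ∈ Set.Ioc 0 T, ∀ w, L (F s) w ≤ (D w w + n s) / 2)
    (heq : ∀ t ∈ Set.Icc 0 T, ∀ b ∈ Set.Icc 0 T,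
      M (v t - v 0) (ι (u b)) + (∫ s in (0 : ℝ)..t, D (v s) (ι (u b))) +
        (∫ s in (0 : ℝ)..t, A (u s) (u b)) = ∫ s in (0 : ℝ)..t, L (F s) (ι (u b)))
    {t : ℝ} (ht : t ∈ Set.Icc 0 T) :
    M (v t) (v t) + A (u t) (u t) + (∫ s in (0 : ℝ)..t, D (v s) (v s)) ≤
      M (v 0) (v 0) + A (u 0) (u 0) + ∫ s in (0 : ℝ)..t, n s := by
  -- The trajectories are extended by their endpoint values, which keeps them continuous. Below, `n`
  -- is extended by zero, which makes it integrable on every interval.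
  set u' : ℝ → X := Set.IccExtend hT.le (Set.domRestrict _ u) with hu'
  set v' : ℝ → H := Set.IccExtend hT.le (Set.domRestrict _ v) with hv'
  have eu : ∀ s ∈ Set.Icc 0 T, u' s = u s := fun s hs => Set.IccExtend_of_mem hT.le _ hs
  have ev : ∀ s ∈ Set.Icc 0 T, v' s = v s := fun s hs => Set.IccExtend_of_mem hT.le _ hs
  have cu : Continuous u' := continuous_IccExtend_iff.2 hu.domRestrict
  have cv : Continuous v' := continuous_IccExtend_iff.2 hv.domRestrict
  have m0 : (0 : ℝ) ∈ Set.Icc 0 T := ⟨le_rfl, hT.le⟩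
  have hsub : ∀ {t}, t ∈ Set.Icc 0 T → Set.uIcc 0 t ⊆ Set.Icc 0 T := fun {t} ht => by
    rw [Set.uIcc_of_le ht.1]; exact Set.Icc_subset_Icc_right ht.2
  have hn' : IntegrableOn n (Set.Ioc 0 T) :=
    (intervalIntegrable_iff_integrableOn_Ioc_of_le hT.le).1 hn
  have main := energy_inequality_of_continuous hM hA (L := L) (ι := ι) (D := D) (F := F)
    (n := (Set.Ioc 0 T).indicator n) cu cv hF
    (fun a b => ((integrable_indicator_iff measurableSet_Ioc).2 hn').intervalIntegrable)
    (fun s hs w => by rw [Set.indicator_of_mem hs]; exact hL s hs w) ?_ ?_ ht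
  · rw [eu t ht, ev t ht, eu 0 m0, ev 0 m0,
      intervalIntegral.integral_congr (g := fun s => D (v s) (v s))
        fun s hs => by simp only [ev s (hsub ht hs)]] at main
    have : (∫ s in (0 : ℝ)..t, (Set.Ioc 0 T).indicator n s) = ∫ s in (0 : ℝ)..t, n s := by
      rw [intervalIntegral.integral_of_le ht.1, intervalIntegral.integral_of_le ht.1]
      refine setIntegral_congr_fun measurableSet_Ioc fun s hs => ?_
      exact Set.indicator_of_mem (show s ∈ Set.Ioc 0 T from ⟨hs.1, hs.2.trans ht.2⟩) n
    rwa [this] at main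
  -- The derivative condition is needed in integrated form, since the extensions need not satisfy it
  -- outside `[0, T]`.
  · intro t ht
    rw [eu t ht, eu 0 m0, eq_comm]
    rw [intervalIntegral.integral_congr (g := v) fun s hs => ev s (hsub ht hs)]
    refine intervalIntegral.integral_eq_sub_of_hasDerivAt_of_le ht.1
      (f := fun s => ι (u s)) (fun s hs => ?_) (fun s hs => ?_) ?_
    · exact (hderiv s ⟨hs.1, hs.2.trans ht.2⟩).continuousWithinAt.mono
        (Set.Icc_subset_Icc_right ht.2)
    · exact (hderiv s ⟨hs.1.le, hs.2.le.trans ht.2⟩).hasDerivAt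
        (Icc_mem_nhds hs.1 (hs.2.trans_le ht.2))
    · exact (hv.mono (hsub ht)).intervalIntegrable
  · intro t ht b hb
    rw [ev t ht, ev 0 m0, eu b hb, ← heq t ht b hb]
    rw [intervalIntegral.integral_congr (f := fun s => D (v' s) (ι (u b)))
        (g := fun s => D (v s) (ι (u b))) fun s hs => by simp only [ev s (hsub ht hs)],
      intervalIntegral.integral_congr (f := fun s => A (u' s) (u b))
        (g := fun s => A (u s) (u b)) fun s hs => by simp only [eu s (hsub ht hs)]]

end EnergyInequality

variable {d : ℕ}

/-! ### Bounded coefficients -/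

/-- A bounded measurable coefficient. -/
def IsBddCoeff (c : Vec d → ℝ) : Prop := Measurable c ∧ ∃ K : ℝ, ∀ x, |c x| ≤ K

namespace IsBddCoeff

variable {c c' : Vec d → ℝ}

lemma mul (h : IsBddCoeff c) (h' : IsBddCoeff c') : IsBddCoeff fun x => c x * c' x := by
  obtain ⟨m, K, hK⟩ := h
  obtain ⟨m', K', hK'⟩ := h'
  refine ⟨m.mul m', K * K', fun x => ?_⟩
  rw [abs_mul]
  exact mul_le_mul (hK x) (hK' x) (abs_nonneg _) ((abs_nonneg _).trans (hK x))

lemma add (h : IsBddCoeff c) (h' : IsBddCoeff c') : IsBddCoeff fun x => c x + c' x := by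
  obtain ⟨m, K, hK⟩ := h
  obtain ⟨m', K', hK'⟩ := h'
  exact ⟨m.add m', K + K', fun x => (abs_add_le _ _).trans (add_le_add (hK x) (hK' x))⟩

lemma const (r : ℝ) : IsBddCoeff fun _ : Vec d => r := ⟨measurable_const, |r|, fun _ => le_rfl⟩

lemma memLp (h : IsBddCoeff c) (Ω : Set (Vec d)) : MemLp c ⊤ (volume.restrict Ω) := by
  obtain ⟨m, K, hK⟩ := h
  exact memLp_top_of_bound m.aestronglyMeasurable K (Eventually.of_forall hK)

end IsBddCoeff

namespace IsPosCoeff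

variable {c c' : Vec d → ℝ}

lemma pos (h : IsPosCoeff c) (x : Vec d) : 0 < c x := by
  obtain ⟨-, a, K, ha, h⟩ := h
  exact ha.trans_le (h x).1

lemma isBddCoeff (h : IsPosCoeff c) : IsBddCoeff c := by
  have hp := h.pos
  obtain ⟨m, a, K, ha, h⟩ := h
  exact ⟨m, K, fun x => by rw [abs_of_pos (hp x)]; exact (h x).2⟩

lemma mul (h : IsPosCoeff c) (h' : IsPosCoeff c') : IsPosCoeff fun x => c x * c' x := by
  have hp := h.pos
  have hp' := h'.pos
  obtain ⟨m, a, K, ha, h⟩ := h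
  obtain ⟨m', a', K', ha', h'⟩ := h'
  exact ⟨m.mul m', a * a', K * K', mul_pos ha ha', fun x =>
    ⟨mul_le_mul (h x).1 (h' x).1 ha'.le (hp x).le,
      mul_le_mul (h x).2 (h' x).2 (hp' x).le ((hp x).le.trans (h x).2)⟩⟩

lemma add (h : IsPosCoeff c) (h' : IsPosCoeff c') : IsPosCoeff fun x => c x + c' x := by
  obtain ⟨m, a, K, ha, h⟩ := h
  obtain ⟨m', a', K', ha', h'⟩ := h'
  exact ⟨m.add m', a + a', K + K', add_pos ha ha', fun x =>
    ⟨add_le_add (h x).1 (h' x).1, add_le_add (h x).2 (h' x).2⟩⟩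

lemma const {r : ℝ} (hr : 0 < r) : IsPosCoeff fun _ : Vec d => r :=
  ⟨measurable_const, r, r, hr, fun _ => ⟨le_rfl, le_rfl⟩⟩

lemma inv (h : IsPosCoeff c) : IsPosCoeff fun x => (c x)⁻¹ := by
  have hp := h.pos
  obtain ⟨m, a, K, ha, h⟩ := h
  exact ⟨m.inv, K⁻¹, a⁻¹, inv_pos.2 ((hp 0).trans_le (h 0).2), fun x =>
    ⟨inv_anti₀ (hp x) (h x).2, inv_anti₀ ha (h x).1⟩⟩

lemma div (h : IsPosCoeff c) (h' : IsPosCoeff c') : IsPosCoeff fun x => c x / c' x := by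
  simpa only [div_eq_mul_inv] using h.mul h'.inv

end IsPosCoeff

/-! ### Bounds for the derived material coefficients. -/

namespace Material

variable (P : Material d)

lemma φ_pos : IsPosCoeff P.φ := by
  obtain ⟨m, a, b, ha, -, h⟩ := P.φ_bounds
  exact ⟨m, a, b, ha, h⟩

lemma one_sub_φ_pos : IsPosCoeff fun x => 1 - P.φ x := by
  obtain ⟨m, a, b, ha, hb, h⟩ := P.φ_bounds
  exact ⟨measurable_const.sub m, 1 - b, 1 - a, by linarith, fun x =>
    ⟨by linarith [(h x).2], by linarith [(h x).1]⟩⟩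

lemma a_pos : IsPosCoeff P.a := by
  obtain ⟨m, K, h⟩ := P.a_gt_one
  exact ⟨m, 1, K, one_pos, fun x => ⟨(h x).1.le, (h x).2⟩⟩

lemma β_pos : IsPosCoeff P.β := by
  obtain ⟨K, hK⟩ := P.β_lipschitz
  obtain ⟨-, a, b, ha, -, h⟩ := P.φ_bounds
  exact ⟨hK.continuous.measurable, a, 1, ha, fun x =>
    ⟨(h x).1.trans (P.β_bounds x).1.le, (P.β_bounds x).2⟩⟩

lemma lam_bdd : IsBddCoeff P.lam := by
  obtain ⟨m, K, h⟩ := P.lam_nonneg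
  exact ⟨m, K, fun x => by rw [abs_of_nonneg (h x).1]; exact (h x).2⟩

lemma ρp_pos : IsPosCoeff P.ρp := (P.φ_pos.mul P.ρf_pos).add (P.one_sub_φ_pos.mul P.ρs_pos)

lemma ρw_pos : IsPosCoeff P.ρw := (P.a_pos.div P.φ_pos).mul P.ρf_pos

lemma ρu_pos : IsPosCoeff P.ρu := (P.one_sub_φ_pos.mul P.ρs_pos).div (.const two_pos)

lemma dampe_pos : IsPosCoeff fun x => 2 * P.ρe x * P.ζ x :=
  ((IsPosCoeff.const two_pos).mul P.ρe_pos).mul P.ζ_pos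

lemma dampp_pos : IsPosCoeff fun x => 2 * P.ρp x * P.ζ x :=
  ((IsPosCoeff.const two_pos).mul P.ρp_pos).mul P.ζ_pos

lemma dampf_pos : IsPosCoeff fun x => P.η x / P.k x := P.η_pos.div P.k_pos

lemma stiffe_pos : IsPosCoeff fun x => P.ρe x * P.ζ x ^ 2 := by
  simpa only [pow_two] using P.ρe_pos.mul (P.ζ_pos.mul P.ζ_pos)

lemma stiffp_pos : IsPosCoeff fun x => P.ρp x * P.ζ x ^ 2 := by
  simpa only [pow_two] using P.ρp_pos.mul (P.ζ_pos.mul P.ζ_pos)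

end Material

/-! ### Weighted pairings on `L²` -/

section Pairing

variable {E F : Type} [NormedAddCommGroup E] [NormedSpace ℝ E] [NormedAddCommGroup F]
  [NormedSpace ℝ F] {c : Vec d → ℝ}

/-- Multiplication by a bounded coefficient on `L²(Ω; E)`. -/
noncomputable def mulCoeff (hc : IsBddCoeff c) (Ω : Set (Vec d)) (E : Type) [NormedAddCommGroup E]
    [NormedSpace ℝ E] : L2 Ω E →L[ℝ] L2 Ω E :=
  (ContinuousLinearMap.lsmul ℝ ℝ).holderL (volume.restrict Ω) ⊤ 2 2 ((hc.memLp Ω).toLp c)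

lemma coeFn_mulCoeff (hc : IsBddCoeff c) (Ω : Set (Vec d)) (f : L2 Ω E) :
    mulCoeff hc Ω E f =ᵐ[volume.restrict Ω] fun x => c x • f x := by
  have h1 := (ContinuousLinearMap.lsmul ℝ ℝ : ℝ →L[ℝ] E →L[ℝ] E).coeFn_holder (r := 2)
    ((hc.memLp Ω).toLp c) f
  rw [mulCoeff, ContinuousLinearMap.holderL_apply_apply]
  filter_upwards [h1, (hc.memLp Ω).coeFn_toLp] with x hx hx'
  rw [hx, hx']
  rfl

/-- The form `(f, g) ↦ ∫_Ω c b(f, g)` on `L²(Ω; E) × L²(Ω; F)`. -/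
noncomputable def weightedPairing (hc : IsBddCoeff c) (Ω : Set (Vec d)) (b : E →L[ℝ] F →L[ℝ] ℝ) :
    L2 Ω E →L[ℝ] L2 Ω F →L[ℝ] ℝ :=
  (b.lpPairing (volume.restrict Ω) 2 2) ∘L mulCoeff hc Ω E

lemma weightedPairing_apply (hc : IsBddCoeff c) (Ω : Set (Vec d)) (b : E →L[ℝ] F →L[ℝ] ℝ)
    (f : L2 Ω E) (g : L2 Ω F) :
    weightedPairing hc Ω b f g = ∫ x in Ω, c x * b (f x) (g x) := by
  rw [weightedPairing, ContinuousLinearMap.comp_apply, ContinuousLinearMap.lpPairing_eq_integral]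
  refine integral_congr_ae ?_
  filter_upwards [coeFn_mulCoeff hc Ω f] with x hx
  rw [hx, map_smul]
  rfl

lemma integrable_pairing (hc : IsBddCoeff c) (Ω : Set (Vec d)) (b : E →L[ℝ] F →L[ℝ] ℝ)
    (f : L2 Ω E) (g : L2 Ω F) :
    Integrable (fun x => c x * b (f x) (g x)) (volume.restrict Ω) := by
  have h := memLp_one_iff_integrable.1
    (b.memLp_of_bilin 1 (Lp.memLp (mulCoeff hc Ω E f)) (Lp.memLp g))
  refine h.congr ?_
  filter_upwards [coeFn_mulCoeff hc Ω f] with x hx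
  rw [hx, map_smul]
  rfl

lemma integrable_inner (hc : IsBddCoeff c) (Ω : Set (Vec d)) (f g : L2 Ω (Vec d)) :
    Integrable (fun x => c x * ⟪f x, g x⟫) (volume.restrict Ω) :=
  integrable_pairing hc Ω (innerSL ℝ) f g

lemma integrable_normSq (hc : IsBddCoeff c) (Ω : Set (Vec d)) (f : L2 Ω (Vec d)) :
    Integrable (fun x => c x * ‖f x‖ ^ 2) (volume.restrict Ω) := by
  simpa only [real_inner_self_eq_norm_sq] using integrable_inner hc Ω f f

end Pairing

/-! ### Weighted forms on `V_0` -/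

section BlockForm

variable {Ωe Ωp : Set (Vec d)} {c₁ c₂ c₃ c₄ : Vec d → ℝ}

/-- The symmetric form on `V_0` with weight `c₁` on `Ω_e` and the weight matrix
`[[c₂, c₃], [c₃, c₄]]` on `Ω_p`. -/
noncomputable def blockForm (Ωe Ωp : Set (Vec d)) (h₁ : IsBddCoeff c₁) (h₂ : IsBddCoeff c₂)
    (h₃ : IsBddCoeff c₃) (h₄ : IsBddCoeff c₄) :
    SpaceV0 Ωe Ωp →L[ℝ] SpaceV0 Ωe Ωp →L[ℝ] ℝ :=
  let pe : SpaceV0 Ωe Ωp →L[ℝ] L2 Ωe (Vec d) := .fst ℝ _ _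
  let pp : SpaceV0 Ωe Ωp →L[ℝ] L2 Ωp (Vec d) := .fst ℝ _ _ ∘L .snd ℝ _ _
  let pf : SpaceV0 Ωe Ωp →L[ℝ] L2 Ωp (Vec d) := .snd ℝ _ _ ∘L .snd ℝ _ _
  (weightedPairing h₁ Ωe (innerSL ℝ)).bilinearComp pe pe +
  (weightedPairing h₂ Ωp (innerSL ℝ)).bilinearComp pp pp +
  (weightedPairing h₃ Ωp (innerSL ℝ)).bilinearComp pf pp +
  (weightedPairing h₃ Ωp (innerSL ℝ)).bilinearComp pp pf +
  (weightedPairing h₄ Ωp (innerSL ℝ)).bilinearComp pf pf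

lemma integrable_quadratic (h₂ : IsBddCoeff c₂) (h₃ : IsBddCoeff c₃) (h₄ : IsBddCoeff c₄)
    (Ω : Set (Vec d)) (f g : L2 Ω (Vec d)) :
    Integrable (fun x => c₂ x * ‖f x‖ ^ 2 + 2 * (c₃ x * ⟪f x, g x⟫) + c₄ x * ‖g x‖ ^ 2)
      (volume.restrict Ω) :=
  ((integrable_normSq h₂ Ω f).add ((integrable_inner h₃ Ω f g).const_mul 2)).add
    (integrable_normSq h₄ Ω g)

variable (h₁ : IsBddCoeff c₁) (h₂ : IsBddCoeff c₂) (h₃ : IsBddCoeff c₃) (h₄ : IsBddCoeff c₄)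

lemma blockForm_apply (U V : SpaceV0 Ωe Ωp) :
    blockForm Ωe Ωp h₁ h₂ h₃ h₄ U V =
      (∫ x in Ωe, c₁ x * ⟪U.1 x, V.1 x⟫) + (∫ x in Ωp, c₂ x * ⟪U.2.1 x, V.2.1 x⟫) +
      (∫ x in Ωp, c₃ x * ⟪U.2.2 x, V.2.1 x⟫) + (∫ x in Ωp, c₃ x * ⟪U.2.1 x, V.2.2 x⟫) +
      (∫ x in Ωp, c₄ x * ⟪U.2.2 x, V.2.2 x⟫) := by
  simp only [blockForm, add_apply, ContinuousLinearMap.bilinearComp_apply,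
    weightedPairing_apply]
  rfl

lemma blockForm_symm (U V : SpaceV0 Ωe Ωp) :
    blockForm Ωe Ωp h₁ h₂ h₃ h₄ U V = blockForm Ωe Ωp h₁ h₂ h₃ h₄ V U := by
  simp only [blockForm_apply]
  simp only [real_inner_comm]
  ring

/-- Collecting the `Ωp` terms under one integral exposes a pointwise quadratic form in the two
fields, so that forms can be compared pointwise. -/
lemma blockForm_self (U : SpaceV0 Ωe Ωp) :
    blockForm Ωe Ωp h₁ h₂ h₃ h₄ U U = (∫ x in Ωe, c₁ x * ‖U.1 x‖ ^ 2) +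
      ∫ x in Ωp, (c₂ x * ‖U.2.1 x‖ ^ 2 + 2 * (c₃ x * ⟪U.2.1 x, U.2.2 x⟫) +
        c₄ x * ‖U.2.2 x‖ ^ 2) := by
  have i₂ := integrable_normSq h₂ Ωp U.2.1
  have i₃ := (integrable_inner h₃ Ωp U.2.1 U.2.2).const_mul 2
  have e₁ := integral_add (i₂.add i₃) (integrable_normSq h₄ Ωp U.2.2)
  have e₂ := integral_add i₂ i₃
  simp only [Pi.add_apply] at e₁
  rw [e₁, e₂, integral_const_mul, blockForm_apply]
  simp only [real_inner_self_eq_norm_sq, real_inner_comm]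
  ring

/-- The hypotheses on `K` are pointwise and do not see the domains; this is the source of a constant
uniform in `Ωe` and `Ωp`. -/
lemma blockForm_self_le {b₁ b₂ b₃ b₄ : Vec d → ℝ} (k₁ : IsBddCoeff b₁) (k₂ : IsBddCoeff b₂)
    (k₃ : IsBddCoeff b₃) (k₄ : IsBddCoeff b₄) {K : ℝ} (he : ∀ x, c₁ x ≤ K * b₁ x)
    (hp : ∀ x (y z : Vec d), c₂ x * ‖y‖ ^ 2 + 2 * (c₃ x * ⟪y, z⟫) + c₄ x * ‖z‖ ^ 2 ≤
      K * (b₂ x * ‖y‖ ^ 2 + 2 * (b₃ x * ⟪y, z⟫) + b₄ x * ‖z‖ ^ 2)) (U : SpaceV0 Ωe Ωp) :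
    blockForm Ωe Ωp h₁ h₂ h₃ h₄ U U ≤ K * blockForm Ωe Ωp k₁ k₂ k₃ k₄ U U := by
  rw [blockForm_self, blockForm_self, mul_add, ← integral_const_mul, ← integral_const_mul]
  refine add_le_add (integral_mono (integrable_normSq h₁ Ωe _)
    ((integrable_normSq k₁ Ωe _).const_mul K) fun x => ?_)
    (integral_mono (integrable_quadratic h₂ h₃ h₄ Ωp _ _)
      ((integrable_quadratic k₂ k₃ k₄ Ωp _ _).const_mul K) fun x => hp x _ _)
  simp only [← mul_assoc]
  exact mul_le_mul_of_nonneg_right (he x) (sq_nonneg _)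

end BlockForm

/-! ### Mass, damping, load and kinetic forms, and their comparison. -/

section MaterialForms

variable {Ωe Ωp : Set (Vec d)} (P : Material d)

/-- The form `𝓜` as a continuous bilinear map. -/
noncomputable def massForm (Ωe Ωp : Set (Vec d)) : SpaceV0 Ωe Ωp →L[ℝ] SpaceV0 Ωe Ωp →L[ℝ] ℝ :=
  blockForm Ωe Ωp P.ρe_pos.isBddCoeff P.ρp_pos.isBddCoeff P.ρf_pos.isBddCoeff P.ρw_pos.isBddCoeff

/-- The form `𝓓` as a continuous bilinear map. -/
noncomputable def dampingForm (Ωe Ωp : Set (Vec d)) : SpaceV0 Ωe Ωp →L[ℝ] SpaceV0 Ωe Ωp →L[ℝ] ℝ :=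
  blockForm Ωe Ωp P.dampe_pos.isBddCoeff P.dampp_pos.isBddCoeff (.const 0) P.dampf_pos.isBddCoeff

/-- The form on the data whose quadratic form is `dataSq`. -/
noncomputable def dataForm (Ωe Ωp : Set (Vec d)) : SpaceV0 Ωe Ωp →L[ℝ] SpaceV0 Ωe Ωp →L[ℝ] ℝ :=
  blockForm Ωe Ωp P.dampe_pos.inv.isBddCoeff P.dampp_pos.inv.isBddCoeff (.const 0)
    P.dampf_pos.inv.isBddCoeff

/-- The unweighted inner product of `V_0`. -/
noncomputable def loadForm (Ωe Ωp : Set (Vec d)) : SpaceV0 Ωe Ωp →L[ℝ] SpaceV0 Ωe Ωp →L[ℝ] ℝ :=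
  blockForm Ωe Ωp (.const 1) (.const 1) (.const 0) (.const 1)

/-- The form on `V_0` whose quadratic form is `normV0Sq`. -/
noncomputable def kineticForm (Ωe Ωp : Set (Vec d)) : SpaceV0 Ωe Ωp →L[ℝ] SpaceV0 Ωe Ωp →L[ℝ] ℝ :=
  blockForm Ωe Ωp P.ρe_pos.isBddCoeff (P.ρu_pos.add (P.ρf_pos.mul P.φ_pos)).isBddCoeff
    P.ρf_pos.isBddCoeff (P.ρf_pos.div P.φ_pos).isBddCoeff

lemma formM_eq (U V : SpaceV0 Ωe Ωp) : formM P U V = massForm P Ωe Ωp U V := by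
  simp only [massForm, blockForm_apply, formM, inner_add_left, real_inner_smul_left]
  rw [integral_add (integrable_inner P.ρp_pos.isBddCoeff Ωp _ _)
    (integrable_inner P.ρf_pos.isBddCoeff Ωp _ _),
    integral_add (integrable_inner P.ρf_pos.isBddCoeff Ωp _ _)
    (integrable_inner P.ρw_pos.isBddCoeff Ωp _ _)]
  ring

lemma formD_eq (U V : SpaceV0 Ωe Ωp) : formD P U V = dampingForm P Ωe Ωp U V := by
  simp [dampingForm, blockForm_apply, formD, real_inner_smul_left]

lemma load_eq (U V : SpaceV0 Ωe Ωp) : load U V = loadForm Ωe Ωp U V := by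
  simp [loadForm, blockForm_apply, load]

lemma dataSq_eq (U : SpaceV0 Ωe Ωp) : dataSq P U = dataForm P Ωe Ωp U U := by
  simp [dataForm, blockForm_apply, dataSq]

/-- Completion of the square, used with `r = φ` for the kinetic norm and with `r` a damping weight
for Young's inequality. -/
lemma norm_add_inv_smul_sq {r : ℝ} (hr : r ≠ 0) (y z : Vec d) :
    r * ‖y + r⁻¹ • z‖ ^ 2 = r * ‖y‖ ^ 2 + 2 * ⟪y, z⟫ + r⁻¹ * ‖z‖ ^ 2 := by
  rw [norm_add_sq_real, real_inner_smul_right, norm_smul, mul_pow, Real.norm_eq_abs, sq_abs]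
  field_simp

lemma normV0Sq_eq (U : SpaceV0 Ωe Ωp) : normV0Sq P U = kineticForm P Ωe Ωp U U := by
  have key : ∀ x, P.ρf x * P.φ x * ‖U.2.1 x + (P.φ x)⁻¹ • U.2.2 x‖ ^ 2 =
      P.ρf x * P.φ x * ‖U.2.1 x‖ ^ 2 + 2 * (P.ρf x * ⟪U.2.1 x, U.2.2 x⟫) +
        P.ρf x / P.φ x * ‖U.2.2 x‖ ^ 2 := fun x => by
    rw [mul_assoc, norm_add_inv_smul_sq (P.φ_pos.pos x).ne']
    ring
  rw [kineticForm, blockForm_self, normV0Sq, add_assoc]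
  simp only [key]
  have e := integral_add (integrable_normSq P.ρu_pos.isBddCoeff Ωp U.2.1)
    (integrable_quadratic (P.ρf_pos.mul P.φ_pos).isBddCoeff P.ρf_pos.isBddCoeff
      (P.ρf_pos.div P.φ_pos).isBddCoeff Ωp U.2.1 U.2.2)
  rw [← e]
  congr 2
  ext x
  ring

/-- On `Ωp` the cross terms coincide and the densities differ by `ρu ‖y‖² + (a - 1) (ρf / φ) ‖z‖²`,
which is nonnegative since `a > 1`. -/
lemma kineticForm_le_massForm (U : SpaceV0 Ωe Ωp) :
    kineticForm P Ωe Ωp U U ≤ massForm P Ωe Ωp U U := by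
  rw [← one_mul (massForm P Ωe Ωp U U)]
  refine blockForm_self_le _ _ _ _ _ _ _ _ (fun x => (one_mul _).ge) (fun x y z => ?_) U
  have h1 := P.φ_pos.pos x
  have h2 := P.one_sub_φ_pos.pos x
  have h3 := P.ρs_pos.pos x
  have h4 := P.ρf_pos.pos x
  obtain ⟨-, K, ha⟩ := P.a_gt_one
  have e1 : P.ρu x + P.ρf x * P.φ x ≤ P.ρp x := by
    rw [Material.ρu, Material.ρp]
    nlinarith [mul_pos h2 h3]
  have e2 : P.ρf x / P.φ x ≤ P.ρw x := by
    rw [Material.ρw, div_mul_eq_mul_div]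
    gcongr
    nlinarith [(ha x).1]
  have := mul_le_mul_of_nonneg_right e1 (sq_nonneg ‖y‖)
  have := mul_le_mul_of_nonneg_right e2 (sq_nonneg ‖z‖)
  linarith

/-- Write `s = ρu ‖y‖²` and `q = ρf φ ‖y + z / φ‖²`. The kinetic density is `s + q`, the mass
density `2 s + q + (a - 1) (ρf / φ) ‖z‖²`. Writing `z` as `φ` times `(y + z / φ) - y` bounds `(ρf /
φ) ‖z‖²` by `2 q + 2 R s`. -/
lemma exists_massForm_le : ∃ K : ℝ, 1 ≤ K ∧ ∀ (Ωe Ωp : Set (Vec d)) (U : SpaceV0 Ωe Ωp),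
    massForm P Ωe Ωp U U ≤ K * kineticForm P Ωe Ωp U U := by
  obtain ⟨-, A, ha⟩ := P.a_gt_one
  obtain ⟨-, R, hR⟩ := ((P.ρf_pos.mul P.φ_pos).div P.ρu_pos).isBddCoeff
  have hA : 1 < A := (ha 0).1.trans_le (ha 0).2
  have hR0 : 0 ≤ R := (abs_nonneg _).trans (hR 0)
  -- `A` bounds `a`, and `R` bounds `ρf φ / ρu`. The constant dominates both coefficients in `(2 + 2
  -- (A - 1) R) s + (1 + 2 (A - 1)) q`.
  refine ⟨2 + 2 * (A - 1) * (1 + R), by nlinarith, fun Ωe Ωp U => ?_⟩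
  refine blockForm_self_le _ _ _ _ _ _ _ _ (fun x => ?_) (fun x y z => ?_) U
  · have := P.ρe_pos.pos x
    have : 0 ≤ (A - 1) * (1 + R) * P.ρe x := by
      have : 0 < A - 1 := by linarith
      positivity
    linarith
  · have h1 := P.φ_pos.pos x
    have h4 := P.ρf_pos.pos x
    have hu := P.ρu_pos.pos x
    have hR' : P.ρf x * P.φ x ≤ R * P.ρu x := by
      have := (le_abs_self _).trans (hR x)
      rwa [div_le_iff₀ hu] at this
    set q : ℝ := P.ρf x * (P.φ x * ‖y + (P.φ x)⁻¹ • z‖ ^ 2) with hq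
    have hq' := hq
    rw [norm_add_inv_smul_sq h1.ne'] at hq'
    have hq0 : 0 ≤ q := by positivity
    have hz : P.ρf x / P.φ x * ‖z‖ ^ 2 ≤ 2 * q + 2 * (P.ρf x * P.φ x * ‖y‖ ^ 2) := by
      have hzz : z = P.φ x • ((y + (P.φ x)⁻¹ • z) - y) := by
        rw [add_sub_cancel_left, smul_smul, mul_inv_cancel₀ h1.ne', one_smul]
      have : ‖z‖ ^ 2 ≤ P.φ x ^ 2 * (2 * ‖y + (P.φ x)⁻¹ • z‖ ^ 2 + 2 * ‖y‖ ^ 2) := by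
        conv_lhs => rw [hzz]
        rw [norm_smul, mul_pow, Real.norm_eq_abs, sq_abs]
        gcongr
        have hn := norm_sub_le (y + (P.φ x)⁻¹ • z) y
        nlinarith [norm_nonneg (y + (P.φ x)⁻¹ • z - y), norm_nonneg y,
          norm_nonneg (y + (P.φ x)⁻¹ • z), sq_nonneg (‖y + (P.φ x)⁻¹ • z‖ - ‖y‖)]
      have h5 := mul_le_mul_of_nonneg_left this (div_pos h4 h1).le
      refine h5.trans_eq ?_
      rw [hq]
      field_simp
    have e1 : P.ρp x = 2 * P.ρu x + P.ρf x * P.φ x := by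
      rw [Material.ρu, Material.ρp]; ring
    have e2 : P.ρw x * ‖z‖ ^ 2 ≤ P.ρf x / P.φ x * ‖z‖ ^ 2 +
        (A - 1) * (P.ρf x / P.φ x * ‖z‖ ^ 2) := by
      have : P.ρw x * ‖z‖ ^ 2 = P.a x * (P.ρf x / P.φ x * ‖z‖ ^ 2) := by
        rw [Material.ρw]; ring
      rw [this]
      have h6 : 0 ≤ P.ρf x / P.φ x * ‖z‖ ^ 2 := by positivity
      nlinarith [mul_le_mul_of_nonneg_right (ha x).2 h6]
    have e3 : (P.ρf x * P.φ x) * ‖y‖ ^ 2 ≤ R * (P.ρu x * ‖y‖ ^ 2) := by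
      rw [← mul_assoc]
      exact mul_le_mul_of_nonneg_right hR' (sq_nonneg _)
    have hu0 : 0 ≤ P.ρu x * ‖y‖ ^ 2 := by positivity
    set s : ℝ := P.ρu x * ‖y‖ ^ 2 with hs
    have hA0 : 0 ≤ A - 1 := by linarith
    have e4 : P.ρf x / P.φ x * ‖z‖ ^ 2 ≤ 2 * q + 2 * (R * s) := by linarith
    have e5 := mul_le_mul_of_nonneg_left e4 hA0
    have e6 : (P.ρu x + P.ρf x * P.φ x) * ‖y‖ ^ 2 + 2 * (P.ρf x * ⟪y, z⟫) +
        P.ρf x / P.φ x * ‖z‖ ^ 2 = s + q := by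
      rw [hq', hs]; ring
    have e7 : P.ρp x * ‖y‖ ^ 2 + 2 * (P.ρf x * ⟪y, z⟫) + P.ρf x / P.φ x * ‖z‖ ^ 2 =
        2 * s + q := by
      rw [hq', hs, e1]; ring
    rw [e6]
    have e8 : 0 ≤ (A - 1) * R * q := by positivity
    have e9 : 0 ≤ (A - 1) * s := by positivity
    nlinarith

/-- Young's inequality with the damping coefficients as weights: each term is the expansion of `c ‖w
- f / c‖² ≥ 0`. -/
lemma loadForm_le (F W : SpaceV0 Ωe Ωp) :
    loadForm Ωe Ωp F W ≤ (dampingForm P Ωe Ωp W W + dataForm P Ωe Ωp F F) / 2 := by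
  have young : ∀ {Ω : Set (Vec d)} {c : Vec d → ℝ} (_ : IsPosCoeff c) (f w : L2 Ω (Vec d)),
      (∫ x in Ω, ⟪f x, w x⟫) ≤
        ((∫ x in Ω, c x * ‖w x‖ ^ 2) + ∫ x in Ω, (c x)⁻¹ * ‖f x‖ ^ 2) / 2 := by
    intro Ω c hc f w
    rw [← integral_add (integrable_normSq hc.isBddCoeff Ω w)
      (integrable_normSq hc.inv.isBddCoeff Ω f), ← integral_div]
    refine integral_mono (by simpa using integrable_inner (.const 1) Ω f w)
      (((integrable_normSq hc.isBddCoeff Ω w).add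
        (integrable_normSq hc.inv.isBddCoeff Ω f)).div_const 2) fun x => ?_
    have h := norm_add_inv_smul_sq (hc.pos x).ne' (w x) (-f x)
    have h0 : 0 ≤ c x * ‖w x + (c x)⁻¹ • -f x‖ ^ 2 :=
      mul_nonneg (hc.pos x).le (sq_nonneg _)
    rw [h, norm_neg, inner_neg_right, real_inner_comm] at h0
    simp only
    linarith
  have y1 := young P.dampe_pos F.1 W.1
  have y2 := young P.dampp_pos F.2.1 W.2.1
  have y3 := young P.dampf_pos F.2.2 W.2.2
  rw [← load_eq, ← formD_eq, ← dataSq_eq, load, dataSq, formD]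
  simp only [real_inner_smul_left, real_inner_self_eq_norm_sq]
  linarith

end MaterialForms

/-! ### The stiffness form -/

lemma jac_add (G G' : Vec d →L[ℝ] Vec d) : jac (G + G') = jac G + jac G' := by
  ext i j; simp [jac]

lemma jac_smul (r : ℝ) (G : Vec d →L[ℝ] Vec d) : jac (r • G) = r • jac G := by
  ext i j; simp [jac]

lemma strain_add (G G' : Vec d →L[ℝ] Vec d) : strain (G + G') = strain G + strain G' := by
  rw [strain, jac_add, Matrix.transpose_add, strain, strain, ← smul_add]
  congr 1
  abel

lemma strain_smul (r : ℝ) (G : Vec d →L[ℝ] Vec d) : strain (r • G) = r • strain G := by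
  rw [strain, jac_smul, Matrix.transpose_smul, strain, ← smul_add, smul_comm]

lemma trace_strain (G : Vec d →L[ℝ] Vec d) : (strain G).trace = divOf G := by
  rw [strain, Matrix.trace_smul, Matrix.trace_add, Matrix.trace_transpose, divOf, smul_eq_mul]
  ring

lemma ddot_add_left (A A' B : Matrix (Fin d) (Fin d) ℝ) : ddot (A + A') B = ddot A B + ddot A' B := by
  simp [ddot, add_mul, Finset.sum_add_distrib]

lemma ddot_smul_left (r : ℝ) (A B : Matrix (Fin d) (Fin d) ℝ) : ddot (r • A) B = r * ddot A B := by
  simp [ddot, Finset.mul_sum, mul_assoc]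

lemma ddot_comm (A B : Matrix (Fin d) (Fin d) ℝ) : ddot A B = ddot B A := by
  simp [ddot, mul_comm]

lemma ddot_one_left (B : Matrix (Fin d) (Fin d) ℝ) : ddot 1 B = B.trace := by
  simp [ddot, Matrix.one_apply, Matrix.trace]

/-- The divergence as a continuous linear functional of the gradient. -/
noncomputable def divL (d : ℕ) : (Vec d →L[ℝ] Vec d) →L[ℝ] ℝ :=
  LinearMap.toContinuousLinearMap
    { toFun := divOf
      map_add' := fun G G' => by rw [divOf, jac_add, Matrix.trace_add]; rfl
      map_smul' := fun r G => by rw [divOf, jac_smul, Matrix.trace_smul]; rfl }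

/-- `(G, H) ↦ ε(G) : ε(H)` as a continuous bilinear map. -/
noncomputable def strainPairing (d : ℕ) : (Vec d →L[ℝ] Vec d) →L[ℝ] (Vec d →L[ℝ] Vec d) →L[ℝ] ℝ :=
  LinearMap.toContinuousBilinearMap <| LinearMap.mk₂ ℝ (fun G H => ddot (strain G) (strain H))
    (fun G G' H => by rw [strain_add, ddot_add_left])
    (fun r G H => by rw [strain_smul, ddot_smul_left]; rfl)
    (fun G H H' => by rw [strain_add, ddot_comm, ddot_add_left, ddot_comm, ddot_comm (strain H')])
    (fun r G H => by rw [strain_smul, ddot_comm, ddot_smul_left, ddot_comm]; rfl)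

/-- Product of two scalar functionals, as a continuous bilinear map. -/
noncomputable def productPairing {E F : Type} [NormedAddCommGroup E] [NormedSpace ℝ E]
    [NormedAddCommGroup F] [NormedSpace ℝ F] (f : E →L[ℝ] ℝ) (g : F →L[ℝ] ℝ) :
    E →L[ℝ] F →L[ℝ] ℝ := (ContinuousLinearMap.mul ℝ ℝ).bilinearComp f g

/-- This splitting shows the symmetry and the sign of the elastic energy, and reduces its continuity
to two pairings with bounded scalar weights. -/
lemma ddot_stress (P : Material d) (x : Vec d) (G H : Vec d →L[ℝ] Vec d) :
    ddot (stress P x G) (strain H) =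
      2 * P.mu x * ddot (strain G) (strain H) + P.lam x * (divOf G * divOf H) := by
  rw [stress, elasticity, ddot_add_left, ddot_smul_left, ddot_smul_left, ddot_one_left,
    trace_strain, trace_strain, mul_assoc (P.lam x)]

section Stiffness

variable (P : Material d) {Ωe Ωp : Set (Vec d)}

lemma two_mu_pos : IsPosCoeff fun x => 2 * P.mu x := (IsPosCoeff.const two_pos).mul P.mu_pos

/-- The elastic part of `𝓐` on `Ω`, as a continuous bilinear form of the gradients. -/
noncomputable def elasticForm (Ω : Set (Vec d)) :
    L2 Ω (Vec d →L[ℝ] Vec d) →L[ℝ] L2 Ω (Vec d →L[ℝ] Vec d) →L[ℝ] ℝ :=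
  weightedPairing (two_mu_pos P).isBddCoeff Ω (strainPairing d) +
    weightedPairing P.lam_bdd Ω (productPairing (divL d) (divL d))

lemma elasticForm_apply (Ω : Set (Vec d)) (G H : L2 Ω (Vec d →L[ℝ] Vec d)) :
    elasticForm P Ω G H = ∫ x in Ω, ddot (stress P x (G x)) (strain (H x)) := by
  simp only [ddot_stress]
  have e := integral_add
    (integrable_pairing (two_mu_pos P).isBddCoeff Ω (strainPairing d) G H)
    (integrable_pairing P.lam_bdd Ω (productPairing (divL d) (divL d)) G H)
  rw [elasticForm, add_apply, add_apply, weightedPairing_apply, weightedPairing_apply]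
  exact e.symm

/-- The field `β ∇ · u_p + ∇ · u_f` as an element of `L²(Ω)`. -/
noncomputable def fluidContentL (Ω : Set (Vec d)) : (H1Graph Ω (Vec d) × HdivGraph Ω) →L[ℝ] L2 Ω ℝ :=
  mulCoeff P.β_pos.isBddCoeff Ω ℝ ∘L (divL d).compLpL 2 (volume.restrict Ω) ∘L
      (.snd ℝ _ _ ∘L .fst ℝ (H1Graph Ω (Vec d)) (HdivGraph Ω)) +
    .snd ℝ _ _ ∘L .snd ℝ (H1Graph Ω (Vec d)) (HdivGraph Ω)

lemma coeFn_fluidContentL (Ω : Set (Vec d)) (u : H1Graph Ω (Vec d) × HdivGraph Ω) :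
    fluidContentL P Ω u =ᵐ[volume.restrict Ω] fluidContent P u.1 u.2 := by
  have h : fluidContentL P Ω u =
      mulCoeff P.β_pos.isBddCoeff Ω ℝ ((divL d).compLp u.1.2) + u.2.2 := rfl
  rw [h]
  filter_upwards [Lp.coeFn_add (mulCoeff P.β_pos.isBddCoeff Ω ℝ ((divL d).compLp u.1.2)) u.2.2,
    coeFn_mulCoeff P.β_pos.isBddCoeff Ω ((divL d).compLp u.1.2),
    (divL d).coeFn_compLp u.1.2] with x h1 h2 h3
  rw [h1, Pi.add_apply, h2, h3]
  rfl

/-- The form `𝓐` as a continuous bilinear map. -/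
noncomputable def stiffnessForm (Ωe Ωp : Set (Vec d)) :
    Ambient Ωe Ωp →L[ℝ] Ambient Ωe Ωp →L[ℝ] ℝ :=
  let pe : Ambient Ωe Ωp →L[ℝ] H1Graph Ωe (Vec d) := .fst ℝ _ _
  let pp : Ambient Ωe Ωp →L[ℝ] H1Graph Ωp (Vec d) := .fst ℝ _ _ ∘L .snd ℝ _ _
  let pθ : Ambient Ωe Ωp →L[ℝ] L2 Ωp ℝ := fluidContentL P Ωp ∘L .snd ℝ _ _
  (elasticForm P Ωe).bilinearComp (.snd ℝ _ _ ∘L pe) (.snd ℝ _ _ ∘L pe) +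
  (weightedPairing P.stiffe_pos.isBddCoeff Ωe (innerSL ℝ)).bilinearComp
    (.fst ℝ _ _ ∘L pe) (.fst ℝ _ _ ∘L pe) +
  (elasticForm P Ωp).bilinearComp (.snd ℝ _ _ ∘L pp) (.snd ℝ _ _ ∘L pp) +
  (weightedPairing P.stiffp_pos.isBddCoeff Ωp (innerSL ℝ)).bilinearComp
    (.fst ℝ _ _ ∘L pp) (.fst ℝ _ _ ∘L pp) +
  (weightedPairing P.m_pos.isBddCoeff Ωp (ContinuousLinearMap.mul ℝ ℝ)).bilinearComp pθ pθ

lemma formA_eq (U V : Ambient Ωe Ωp) : formA P U V = stiffnessForm P Ωe Ωp U V := by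
  have h : stiffnessForm P Ωe Ωp U V = elasticForm P Ωe U.1.2 V.1.2 +
      weightedPairing P.stiffe_pos.isBddCoeff Ωe (innerSL ℝ) U.1.1 V.1.1 +
      elasticForm P Ωp U.2.1.2 V.2.1.2 +
      weightedPairing P.stiffp_pos.isBddCoeff Ωp (innerSL ℝ) U.2.1.1 V.2.1.1 +
      weightedPairing P.m_pos.isBddCoeff Ωp (ContinuousLinearMap.mul ℝ ℝ)
        (fluidContentL P Ωp U.2) (fluidContentL P Ωp V.2) := rfl
  rw [h, elasticForm_apply, elasticForm_apply, weightedPairing_apply, weightedPairing_apply,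
    weightedPairing_apply, formA]
  simp only [real_inner_smul_left]
  congr 1
  refine integral_congr_ae ?_
  filter_upwards [coeFn_fluidContentL P Ωp U.2, coeFn_fluidContentL P Ωp V.2] with x h1 h2
  rw [h1, h2, mul_assoc]
  rfl

lemma stiffnessForm_symm (U V : Ambient Ωe Ωp) :
    stiffnessForm P Ωe Ωp U V = stiffnessForm P Ωe Ωp V U := by
  have hs : ∀ x G H, ddot (stress P x G) (strain H) = ddot (stress P x H) (strain G) :=
    fun x G H => by rw [ddot_stress, ddot_stress, ddot_comm, mul_comm (divOf G)]
  rw [← formA_eq, ← formA_eq, formA, formA]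
  simp only [real_inner_smul_left]
  refine congrArg₂ _ (congrArg₂ _ (congrArg₂ _ (congrArg₂ _ ?_ ?_) ?_) ?_) ?_ <;>
    refine integral_congr_ae (Eventually.of_forall fun x => ?_)
  · exact hs _ _ _
  · simp only [real_inner_comm]
  · exact hs _ _ _
  · simp only [real_inner_comm]
  · simp only [mul_right_comm]

lemma seminormVSq_eq (U : Ambient Ωe Ωp) : seminormVSq P U = stiffnessForm P Ωe Ωp U U := by
  rw [← formA_eq, formA, seminormVSq]
  simp only [real_inner_smul_left, real_inner_self_eq_norm_sq, pow_two (fluidContent P _ _ _),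
    mul_assoc]
  rfl

lemma ddot_self_nonneg (A : Matrix (Fin d) (Fin d) ℝ) : 0 ≤ ddot A A :=
  Finset.sum_nonneg fun _ _ => Finset.sum_nonneg fun _ _ => mul_self_nonneg _

lemma stiffnessForm_self_nonneg (U : Ambient Ωe Ωp) : 0 ≤ stiffnessForm P Ωe Ωp U U := by
  have hel : ∀ x G, 0 ≤ ddot (elasticity P x (strain G)) (strain G) := fun x G => by
    have h := ddot_stress P x G G
    rw [stress] at h
    rw [h]
    obtain ⟨-, K, hl⟩ := P.lam_nonneg
    have := P.mu_pos.pos x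
    exact add_nonneg (mul_nonneg (by positivity) (ddot_self_nonneg _))
      (mul_nonneg (hl x).1 (mul_self_nonneg _))
  rw [← seminormVSq_eq, seminormVSq]
  have h1 := fun x => P.stiffe_pos.pos x
  have h2 := fun x => P.stiffp_pos.pos x
  have h3 := fun x => P.m_pos.pos x
  refine add_nonneg (add_nonneg (add_nonneg (add_nonneg ?_ ?_) ?_) ?_) ?_ <;>
    refine integral_nonneg fun x => ?_
  · exact hel x _
  · exact mul_nonneg (h1 x).le (sq_nonneg _)
  · exact hel x _
  · exact mul_nonneg (h2 x).le (sq_nonneg _)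
  · exact mul_nonneg (h3 x).le (sq_nonneg _)

end Stiffness

/-! ### The interface form on admissible test functions -/

section Interface

variable {P : Material d} {Ωe Ωp : Set (Vec d)}

/-- By the fundamental lemma of the calculus of variations. It identifies the divergence chosen in
`IsPressurePairing` with the one chosen in `NoFlow`. -/
lemma weakDiv_unique {Ω : Set (Vec d)} (hΩ : IsOpen Ω) {z : Vec d → Vec d} {g g' : L2 Ω ℝ}
    (h : IsWeakDiv Ω z g) (h' : IsWeakDiv Ω z g') : g =ᵐ[volume.restrict Ω] g' := by
  have hloc : ∀ f : L2 Ω ℝ, LocallyIntegrable f (volume.restrict Ω) := fun f =>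
    (Lp.memLp f).locallyIntegrable (by norm_num)
  have h0 := hΩ.ae_eq_zero_of_integral_contDiff_smul_eq_zero (f := fun x => g x - g' x)
    (((hloc g).sub (hloc g')).locallyIntegrableOn Ω) fun ψ h1 h2 h3 => by
      have e := (h ψ ⟨h1, h2, h3⟩).symm.trans (h' ψ ⟨h1, h2, h3⟩)
      have hi : ∀ f : L2 Ω ℝ, Integrable (fun x => ψ x * f x) (volume.restrict Ω) := fun f => by
        simpa using (hloc f).integrable_smul_left_of_hasCompactSupport h1.continuous h2
      simp only [smul_eq_mul, mul_sub]
      rw [integral_sub (hi g) (hi g')]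
      linarith
  filter_upwards [h0, self_mem_ae_restrict hΩ.measurableSet] with x hx hm
  exact sub_eq_zero.1 (hx hm)

/-- The pressure belongs to `H¹(Ωp)`, so it is one of the functions that the vanishing normal flux
annihilates. It only has to be replaced by its `L²` class. -/
lemma pressurePairing_eq_zero (hΩ : IsOpen Ωp) {up vp : H1Graph Ωp (Vec d)} {uf vf : HdivGraph Ωp}
    (h : NoFlow P vp vf) {c : ℝ} (hc : IsPressurePairing P up uf vp vf c) : c = 0 := by
  obtain ⟨Q, g, hQ, hg, rfl⟩ := hc
  obtain ⟨g', hg', h0⟩ := h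
  set p : L2 Ωp ℝ := - mulCoeff P.m_pos.isBddCoeff Ωp ℝ (fluidContentL P Ωp (up, uf)) with hp
  have hpe : p =ᵐ[volume.restrict Ωp] pressure P up uf := by
    filter_upwards [Lp.coeFn_neg (mulCoeff P.m_pos.isBddCoeff Ωp ℝ (fluidContentL P Ωp (up, uf))),
      coeFn_mulCoeff P.m_pos.isBddCoeff Ωp (fluidContentL P Ωp (up, uf)),
      coeFn_fluidContentL P Ωp (up, uf)] with x e1 e2 e3
    rw [hp, e1, Pi.neg_apply, e2, e3, pressure, smul_eq_mul, neg_mul]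
  rw [← h0 (p, Q) fun ψ hψ e => ?_]
  · refine integral_congr_ae ?_
    filter_upwards [hpe, weakDiv_unique hΩ hg hg'] with x e1 e2
    rw [e1, e2]
  · rw [← hQ ψ hψ e]
    refine integral_congr_ae ?_
    filter_upwards [hpe] with x e1
    rw [e1]

lemma eLpNorm_sub_coeFn_zero {E : Type} [NormedAddCommGroup E] (Ω : Set (Vec d)) {f : Vec d → E}
    (hf : ∀ x, f x = 0) : eLpNorm (f - ⇑(0 : L2 Ω E)) 2 (volume.restrict Ω) = 0 := by
  have h : f - ⇑(0 : L2 Ω E) =ᵐ[volume.restrict Ω] fun _ => 0 := by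
    filter_upwards [Lp.coeFn_zero E 2 (volume.restrict Ω)] with x hx
    rw [Pi.sub_apply, hx, hf, Pi.zero_apply, sub_zero]
  exact (eLpNorm_congr_ae h).trans (by simp)

lemma isTrace_zero {F : Type} [NormedAddCommGroup F] [NormedSpace ℝ F] (Ω : Set (Vec d)) :
    IsTrace Ω (0 : H1Graph Ω F).1 (0 : H1Graph Ω F).2 0 :=
  ⟨MemLp.zero, fun _ _ => 0, fun _ => contDiff_const,
    tendsto_const_nhds.congr fun _ => (eLpNorm_sub_coeFn_zero Ω fun _ => rfl).symm,
    tendsto_const_nhds.congr fun _ => (eLpNorm_sub_coeFn_zero Ω fun x => by simp).symm,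
    tendsto_const_nhds.congr fun _ => by
      rw [show (fun _ : Vec d => (0 : F)) - 0 = 0 from sub_self 0]
      exact eLpNorm_zero.symm⟩

lemma memH1_zero {F : Type} [NormedAddCommGroup F] [NormedSpace ℝ F] (Ω : Set (Vec d)) :
    MemH1 Ω (0 : H1Graph Ω F) := by
  intro ψ _ e
  have h1 : ∫ x in Ω, (fderiv ℝ ψ x e) • (0 : L2 Ω F) x = 0 := by
    refine integral_eq_zero_of_ae ?_
    filter_upwards [Lp.coeFn_zero F 2 (volume.restrict Ω)] with x hx
    simp only [hx, Pi.zero_apply, smul_zero]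
  have h2 : ∫ x in Ω, ψ x • (0 : L2 Ω (Vec d →L[ℝ] F)) x e = 0 := by
    refine integral_eq_zero_of_ae ?_
    filter_upwards [Lp.coeFn_zero (Vec d →L[ℝ] F) 2 (volume.restrict Ω)] with x hx
    simp only [hx, Pi.zero_apply, zero_apply, smul_zero]
  exact h1.trans (by rw [← neg_zero, ← h2]; rfl)

/-- When the jump across the interface is zero, the zero field lifts it. -/
lemma isLifting_zero {ve : H1Graph Ωe (Vec d)} {vp : H1Graph Ωp (Vec d)}
    (h : AgreeOnInterface Ωe Ωp ve vp) : IsLifting Ωe Ωp ve vp 0 := by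
  obtain ⟨τe, τp, he, hp, hag⟩ := h
  refine ⟨⟨memH1_zero Ωe, 0, isTrace_zero Ωe, by simp⟩, τe, τp, 0, he, hp, isTrace_zero Ωe, ?_⟩
  filter_upwards [hag] with x hx
  simp [hx]

/-- Green's formula gives the same value for every lifting of the jump, so it may be evaluated at
the zero lifting. -/
lemma stressPairing_eq_zero {ue ve : H1Graph Ωe (Vec d)} {vp : H1Graph Ωp (Vec d)}
    (h : AgreeOnInterface Ωe Ωp ve vp) {c : ℝ} (hc : IsStressPairing P ue ve vp c) : c = 0 := by
  obtain ⟨s, -, -, hc⟩ := hc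
  rw [hc 0 (isLifting_zero h)]
  refine integral_eq_zero_of_ae ?_
  filter_upwards [Lp.coeFn_zero (Vec d) 2 (volume.restrict Ωe),
    Lp.coeFn_zero (Vec d →L[ℝ] Vec d) 2 (volume.restrict Ωe)] with x h1 h2
  simp only [Prod.fst_zero, Prod.snd_zero, h1, h2, Pi.zero_apply]
  simp [ddot, jac]

/-- The interface form vanishes when the test function satisfies the interface conditions. -/
lemma formC_eq_zero (hΩ : IsOpen Ωp) {U V : Ambient Ωe Ωp} (hag : AgreeOnInterface Ωe Ωp V.1 V.2.1)
    (hno : NoFlow P V.2.1 V.2.2) {c : ℝ} (hc : IsFormC P U V c) : c = 0 := by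
  obtain ⟨c₁, c₂, h₁, h₂, rfl⟩ := hc
  rw [stressPairing_eq_zero hag h₁, pressurePairing_eq_zero hΩ hno h₂, add_zero]

end Interface

/-! ### Stability -/

section Stability

variable {P : Material d} {Ωe Ωp : Set (Vec d)} {T : ℝ} {F : ℝ → SpaceV0 Ωe Ωp}
  {U₀ : Ambient Ωe Ωp} {V₀ : SpaceV0 Ωe Ωp} {U : ℝ → Ambient Ωe Ωp} {Udot : ℝ → SpaceV0 Ωe Ωp}

/-- The map `(u_e, u_p, u_f) ↦ (u_e, u_p, u_f)` from `V` to `V_0`, as a continuous linear map. -/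
noncomputable def toV0L (Ωe Ωp : Set (Vec d)) : Ambient Ωe Ωp →L[ℝ] SpaceV0 Ωe Ωp :=
  (ContinuousLinearMap.fst ℝ _ _).prodMap
    ((ContinuousLinearMap.fst ℝ _ _).prodMap (ContinuousLinearMap.fst ℝ _ _))

lemma toV0L_apply (U : Ambient Ωe Ωp) : toV0L Ωe Ωp U = toV0 U := rfl

/-- Young's inequality with one argument zero; the damping form is treated likewise. -/
lemma dataForm_nonneg (F : SpaceV0 Ωe Ωp) : 0 ≤ dataForm P Ωe Ωp F F := by
  have := loadForm_le P F 0
  simp only [map_zero] at this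
  linarith

variable (P) in
lemma dampingForm_self_nonneg (V : SpaceV0 Ωe Ωp) : 0 ≤ dampingForm P Ωe Ωp V V := by
  have := loadForm_le P 0 V
  simp only [map_zero, zero_apply] at this
  linarith

lemma intervalIntegrable_load (hF : MemLp F 2 (volume.restrict (Set.Ioo 0 T))) (hT : 0 ≤ T) :
    IntervalIntegrable F volume 0 T := by
  rw [intervalIntegrable_iff_integrableOn_Ioc_of_le hT, integrableOn_Ioc_iff_integrableOn_Ioo]
  exact hF.integrable (by norm_num)

lemma intervalIntegrable_dataForm (hF : MemLp F 2 (volume.restrict (Set.Ioo 0 T))) (hT : 0 ≤ T) :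
    IntervalIntegrable (fun s => dataForm P Ωe Ωp (F s) (F s)) volume 0 T := by
  rw [intervalIntegrable_iff_integrableOn_Ioc_of_le hT, integrableOn_Ioc_iff_integrableOn_Ioo]
  exact memLp_one_iff_integrable.1 ((dataForm P Ωe Ωp).memLp_of_bilin 1 hF hF)

/-- Energy estimate for weak solutions. -/
theorem IsWeakSolution.energy_le (hΩ : IsOpen Ωp) (hT : 0 < T)
    (hF : MemLp F 2 (volume.restrict (Set.Ioo 0 T))) (h : IsWeakSolution P T F U₀ V₀ U Udot)
    {t : ℝ} (ht : t ∈ Set.Icc 0 T) :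
    massForm P Ωe Ωp (Udot t) (Udot t) + stiffnessForm P Ωe Ωp (U t) (U t) +
      (∫ s in (0 : ℝ)..t, dampingForm P Ωe Ωp (Udot s) (Udot s)) ≤
    massForm P Ωe Ωp V₀ V₀ + stiffnessForm P Ωe Ωp U₀ U₀ +
      ∫ s in (0 : ℝ)..t, dataForm P Ωe Ωp (F s) (F s) := by
  have hv : ContinuousOn Udot (Set.Icc 0 T) := h.continuousOn_deriv
  rw [← h.initial, ← h.initial_deriv]
  refine energy_inequality (ι := toV0L Ωe Ωp) (L := loadForm Ωe Ωp)
    (fun _ _ => blockForm_symm _ _ _ _ _ _) (stiffnessForm_symm P) hT h.continuousOn hv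
    h.hasDeriv (intervalIntegrable_load hF hT.le) (intervalIntegrable_dataForm hF hT.le)
    (fun s _ w => loadForm_le P (F s) w) (fun t ht b hb => ?_) ht
  -- The test function `U b` satisfies both interface conditions, which kills the interface term
  -- whatever its first argument.
  obtain ⟨c, hc, he⟩ := h.equation t ht (U b) (h.memV b hb)
  rw [formC_eq_zero hΩ (h.agree b hb) (h.noFlow b hb) hc, add_zero] at he
  simp only [formM_eq, formD_eq, formA_eq, load_eq] at he
  simp only [toV0L_apply, map_sub, sub_apply, h.initial_deriv]
  exact he

lemma energySq_eq (t : ℝ) : energySq P U Udot t =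
    kineticForm P Ωe Ωp (Udot t) (Udot t) + stiffnessForm P Ωe Ωp (U t) (U t) +
      (∫ s in (0 : ℝ)..t, dampingForm P Ωe Ωp (Udot s) (Udot s)) +
      dampingForm P Ωe Ωp (toV0 (U 0)) (toV0 (U 0)) := by
  simp only [energySq, normV0Sq_eq, seminormVSq_eq, formD_eq]

/-- Continuity on the compact interval is what makes the maximum attained. -/
lemma IsWeakSolution.continuousOn_energySq (hT : 0 < T) (h : IsWeakSolution P T F U₀ V₀ U Udot) :
    ContinuousOn (energySq P U Udot) (Set.Icc 0 T) := by
  have hv := h.continuousOn_deriv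
  have hu := h.continuousOn
  have hD : ContinuousOn (fun s => dampingForm P Ωe Ωp (Udot s) (Udot s)) (Set.Icc 0 T) := by
    fun_prop
  have hI : ContinuousOn (fun t => ∫ s in (0 : ℝ)..t, dampingForm P Ωe Ωp (Udot s) (Udot s))
      (Set.Icc 0 T) := by
    have := intervalIntegral.continuousOn_primitive_interval (μ := volume) (a := 0) (b := T)
      (f := fun s => dampingForm P Ωe Ωp (Udot s) (Udot s))
      (by rw [Set.uIcc_of_le hT.le]; exact hD.integrableOn_compact isCompact_Icc)
    rwa [Set.uIcc_of_le hT.le] at this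
  simp only [funext (energySq_eq (P := P) (U := U) (Udot := Udot))]
  fun_prop

end Stability

end PoroElastic

theorem theorem2p1 (d : ℕ) (hd : d = 2 ∨ d = 3) (P : PoroElastic.Material d)
    (T : ℝ) (hT : 0 < T) :
    ∃ C : ℝ, 0 < C ∧
      ∀ Ωe Ωp : Set (PoroElastic.Vec d),
        PoroElastic.IsLipschitzDomain Ωe → PoroElastic.IsLipschitzDomain Ωp → Disjoint Ωe Ωp →
      ∀ (F : ℝ → PoroElastic.SpaceV0 Ωe Ωp) (U₀ : PoroElastic.Ambient Ωe Ωp)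
        (V₀ : PoroElastic.SpaceV0 Ωe Ωp),
        MemLp F 2 (volume.restrict (Set.Ioo 0 T)) → PoroElastic.MemV Ωe Ωp U₀ →
      ∀ (U : ℝ → PoroElastic.Ambient Ωe Ωp) (Udot : ℝ → PoroElastic.SpaceV0 Ωe Ωp),
        PoroElastic.IsWeakSolution P T F U₀ V₀ U Udot →
        ∃ t₀ ∈ Set.Icc (0 : ℝ) T,
          (∀ t ∈ Set.Icc (0 : ℝ) T,
            PoroElastic.energySq P U Udot t ≤ PoroElastic.energySq P U Udot t₀) ∧
          PoroElastic.energySq P U Udot t₀ ≤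
            C * (PoroElastic.initialEnergySq P U₀ V₀ +
              ∫ s in (0 : ℝ)..T, PoroElastic.dataSq P (F s)) := by
  obtain ⟨K, hK, hMK⟩ := PoroElastic.exists_massForm_le P
  -- The only loss is the comparison of the mass form at `V₀` with the kinetic norm. As `1 ≤ K`, the
  -- same constant serves for the stiffness, damping and data terms, and it depends on the
  -- coefficients alone.
  refine ⟨K, by linarith, fun Ωe Ωp _ hΩp _ F U₀ V₀ hF _ U Udot h => ?_⟩
  obtain ⟨t₀, ht₀, hmax⟩ := isCompact_Icc.exists_isMaxOn ⟨0, le_rfl, hT.le⟩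
    (h.continuousOn_energySq hT)
  refine ⟨t₀, ht₀, fun t ht => hmax ht, ?_⟩
  have e1 := h.energy_le hΩp.1 hT hF ht₀
  have e2 := PoroElastic.kineticForm_le_massForm P (Udot t₀)
  have e3 := hMK Ωe Ωp V₀
  have hmono : (∫ s in (0 : ℝ)..t₀, PoroElastic.dataForm P Ωe Ωp (F s) (F s)) ≤
      ∫ s in (0 : ℝ)..T, PoroElastic.dataForm P Ωe Ωp (F s) (F s) :=
    intervalIntegral.integral_mono_interval le_rfl ht₀.1 ht₀.2
      (Eventually.of_forall fun s => PoroElastic.dataForm_nonneg (F s))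
      (PoroElastic.intervalIntegrable_dataForm hF hT.le)
  have hdata : 0 ≤ ∫ s in (0 : ℝ)..T, PoroElastic.dataForm P Ωe Ωp (F s) (F s) :=
    intervalIntegral.integral_nonneg hT.le fun s _ => PoroElastic.dataForm_nonneg (F s)
  have hA := PoroElastic.stiffnessForm_self_nonneg P U₀
  have hD := PoroElastic.dampingForm_self_nonneg P (PoroElastic.toV0 U₀)
  rw [PoroElastic.energySq_eq, PoroElastic.initialEnergySq, PoroElastic.normV0Sq_eq,
    PoroElastic.seminormVSq_eq, PoroElastic.formD_eq, h.initial]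
  simp only [PoroElastic.dataSq_eq]
  have f1 := mul_le_mul_of_nonneg_right hK hA
  have f2 := mul_le_mul_of_nonneg_right hK hD
  have f3 := mul_le_mul_of_nonneg_right hK hdata
  linarith
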